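/- Let $\Omega\subsetneq\mathbb{R}^n$ be a domain (a nonempty, open, connected set), let $d(x,y)$, $x,y\in\Omega$, be its internal metric, i.e. the infimum of the Euclidean lengths of rectifiable curves in $\Omega$ joining $x$ to $y$, and let $d(x)$ be the Euclidean distance from $x\in\Omega$ to $\partial\Omega$. Assume that $\Omega$ is a John domain: there are $0<\alpha\le1$ and $x_0\in\Omega$ such that every $x\in\Omega$ can be joined to $x_0$ by an arc-length parametrized curve $\gamma$ in $\Omega$, starting at $x$, with $d(\gamma(t))\ge\alpha t$ for all $0\le t\le\ell(\gamma)$, where $\ell(\gamma)$ is the length of $\gamma$. Let $\rho\colon\Omega\to(0,\infty)$ be continuous, with $\rho>c$ on $\Omega$ for some constant $c>0$, and let $d_\rho(x,y)=\inf_\gamma\int_\gamma\rho(z)\,|dz|$, the infimum over all rectifiable curves $\gamma$ in $\Omega$ joining $x$ to $y$. Let $\partial_d\Omega$ and $\partial_\rho\Omega$ be the internal boundary and the $\rho$-boundary of $\Omega$, that is, the metric completions of $(\Omega,d)$ and of $(\Omega,d_\rho)$ with $\Omega$ removed. Denote by $\dim_d,\operatorname{Dim}_d$ and $\dim_\rho,\operatorname{Dim}_\rho$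 the Hausdorff and packing dimensions in these two completions. Suppose that for every $x\in\partial_d\Omega$ the limit $$i(x)=\lim_{y\in\Omega,\;y\to x}\frac{\log\rho(y)}{\log d(y)}$$ (with $y\to x$ in the completion of $(\Omega,d)$) exists and satisfies $i(x)>-1$. Then $$\dim_\rho(\partial_\rho\Omega)=\sup_{\beta>-1}\frac{\dim_d\{x\in\partial_d\Omega: i(x)\le\beta\}}{1+\beta} \quad\text{and}\quad \operatorname{Dim}_\rho(\partial_\rho\Omega)=\sup_{\beta>-1}\frac{\operatorname{Dim}_d\{x\in\partial_d\Omega: i(x)\le\beta\}}{1+\beta}.$$ -/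

import Mathlib

open Set Filter Topology MeasureTheory
open scoped NNReal ENNReal

noncomputable section

namespace DensityMetric

/-! ### Curves -/

/-- `γ : [0, L] → ℝⁿ` is a rectifiable curve of length `L`, parametrized by arc length, that lies
in `Ω` and joins `x` to `y`. -/
structure IsCurve {n : ℕ} (Ω : Set (EuclideanSpace ℝ (Fin n))) (x y : EuclideanSpace ℝ (Fin n))
    (L : ℝ) (γ : ℝ → EuclideanSpace ℝ (Fin n)) : Prop where
  nonneg : 0 ≤ L
  arclength : HasUnitSpeedOn γ (Icc 0 L)
  source : γ 0 = x
  target : γ L = y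
  mem : ∀ t ∈ Icc 0 L, γ t ∈ Ω

section Curves

variable {n : ℕ} {Ω : Set (EuclideanSpace ℝ (Fin n))} {x y z : EuclideanSpace ℝ (Fin n)}
  {L M : ℝ} {γ η : ℝ → EuclideanSpace ℝ (Fin n)}

theorem hasUnitSpeedOn_comp_affine_iff {f : ℝ → EuclideanSpace ℝ (Fin n)} {a b c : ℝ} :
    HasUnitSpeedOn (fun t => f (t - c)) (Icc (a + c) (b + c)) ↔ HasUnitSpeedOn f (Icc a b) := by
  have key : ∀ u v : ℝ, a ≤ u → v ≤ b →
      eVariationOn (fun t => f (t - c)) (Icc (a + c) (b + c) ∩ Icc (u + c) (v + c))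
        = eVariationOn f (Icc a b ∩ Icc u v) := by
    intro u v _ _
    have h := eVariationOn.comp_eq_of_monotoneOn f (t := Icc (a + c) (b + c) ∩ Icc (u + c) (v + c))
      (fun t : ℝ => t - c) (fun p _ q _ hpq => by simpa using hpq)
    have him : (fun t : ℝ => t - c) '' (Icc (a + c) (b + c) ∩ Icc (u + c) (v + c))
        = Icc a b ∩ Icc u v := by
      rw [Icc_inter_Icc, Icc_inter_Icc, image_sub_const_Icc]
      congr 1 <;> simp [max_add_add_right, min_add_add_right]
    rw [him] at h
    exact h
  constructor
  · intro h u hu v hv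
    have := h (x := u + c) ⟨by linarith [hu.1], by linarith [hu.2]⟩ (y := v + c)
      ⟨by linarith [hv.1], by linarith [hv.2]⟩
    rw [key u v hu.1 hv.2] at this
    rw [this]; congr 2; ring
  · intro h u hu v hv
    have := h (x := u - c) ⟨by linarith [hu.1], by linarith [hu.2]⟩ (y := v - c)
      ⟨by linarith [hv.1], by linarith [hv.2]⟩
    rw [← key (u - c) (v - c) (by linarith [hu.1]) (by linarith [hv.2])] at this
    simp only [sub_add_cancel] at this
    rw [this]; congr 2; ring

theorem IsCurve.lipschitz (h : IsCurve Ω x y L γ) : LipschitzOnWith 1 γ (Icc 0 L) := by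
  intro s hs t ht
  wlog hst : s ≤ t generalizing s t
  · rw [edist_comm, edist_comm s]; exact this ht hs (le_of_not_ge hst)
  have h1 := eVariationOn.edist_le γ (s := Icc 0 L ∩ Icc s t) (x := s) (y := t)
    ⟨hs, le_rfl, hst⟩ ⟨ht, hst, le_rfl⟩
  rw [h.arclength hs ht] at h1
  refine h1.trans (le_of_eq ?_)
  rw [edist_dist, Real.dist_eq, abs_sub_comm, abs_of_nonneg (sub_nonneg.2 hst)]
  simp

theorem IsCurve.continuousOn (h : IsCurve Ω x y L γ) : ContinuousOn γ (Icc 0 L) :=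
  h.lipschitz.continuousOn

theorem IsCurve.refl (hx : x ∈ Ω) : IsCurve Ω x x 0 (fun _ => x) where
  nonneg := le_rfl
  arclength := hasConstantSpeedOnWith_of_subsingleton _ (by simp) _
  source := rfl
  target := rfl
  mem := fun _ _ => hx

theorem IsCurve.reverse (h : IsCurve Ω x y L γ) : IsCurve Ω y x L (fun t => γ (L - t)) where
  nonneg := h.nonneg
  arclength := by
    intro u hu v hv
    have h1 := eVariationOn.comp_eq_of_antitoneOn γ (t := Icc 0 L ∩ Icc u v)
      (fun t : ℝ => L - t) (fun p _ q _ hpq => sub_le_sub_left hpq L)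
    have him : (fun t : ℝ => L - t) '' (Icc 0 L ∩ Icc u v) = Icc 0 L ∩ Icc (L - v) (L - u) := by
      ext w
      simp only [mem_image, mem_inter_iff, mem_Icc]
      constructor
      · rintro ⟨t, ⟨⟨a1, a2⟩, a3, a4⟩, rfl⟩
        refine ⟨⟨?_, ?_⟩, ?_, ?_⟩ <;> linarith
      · rintro ⟨⟨a1, a2⟩, a3, a4⟩
        refine ⟨L - w, ⟨⟨?_, ?_⟩, ?_, ?_⟩, ?_⟩ <;> linarith
    rw [him] at h1
    have h2 := h.arclength (show L - v ∈ Icc 0 L from ⟨by linarith [hv.2], by linarith [hv.1]⟩)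
      (show L - u ∈ Icc 0 L from ⟨by linarith [hu.2], by linarith [hu.1]⟩)
    rw [h2] at h1
    refine Eq.trans h1 ?_
    congr 2; ring
  source := by simpa using h.target
  target := by simpa using h.source
  mem := fun t ht => h.mem _ ⟨by linarith [ht.2], by linarith [ht.1]⟩

/-- Concatenation of two curves. -/
def concat (L : ℝ) (γ η : ℝ → EuclideanSpace ℝ (Fin n)) : ℝ → EuclideanSpace ℝ (Fin n) :=
  fun t => if t ≤ L then γ t else η (t - L)

theorem concat_eqOn_left : EqOn (concat L γ η) γ (Icc 0 L) := fun t ht => by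
  simp [concat, ht.2]

theorem concat_eqOn_right (h1 : IsCurve Ω x y L γ) (h2 : IsCurve Ω y z M η) :
    EqOn (concat L γ η) (fun t => η (t - L)) (Icc L (L + M)) := fun t ht => by
  rcases eq_or_lt_of_le ht.1 with h | h
  · subst h; simp [concat, h1.target, h2.source]
  · simp [concat, not_le.2 h]

theorem hasUnitSpeedOn_congr {f g : ℝ → EuclideanSpace ℝ (Fin n)} {s : Set ℝ} (h : EqOn f g s)
    (hg : HasUnitSpeedOn g s) : HasUnitSpeedOn f s := by
  intro u hu v hv
  rw [eVariationOn.eq_of_eqOn (h.mono inter_subset_left)]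
  exact hg hu hv

theorem IsCurve.trans (h1 : IsCurve Ω x y L γ) (h2 : IsCurve Ω y z M η) :
    IsCurve Ω x z (L + M) (concat L γ η) where
  nonneg := add_nonneg h1.nonneg h2.nonneg
  arclength := by
    refine HasUnitSpeedOn.Icc_Icc (y := L) (hasUnitSpeedOn_congr concat_eqOn_left h1.arclength)
      (hasUnitSpeedOn_congr (concat_eqOn_right h1 h2) ?_)
    have := (hasUnitSpeedOn_comp_affine_iff (f := η) (a := 0) (b := M) (c := L)).2 h2.arclength
    rwa [zero_add, add_comm M L] at this
  source := by
    rw [concat_eqOn_left ⟨le_rfl, h1.nonneg⟩, h1.source]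
  target := by
    rw [concat_eqOn_right h1 h2 ⟨by linarith [h2.nonneg], le_rfl⟩]
    simpa using h2.target
  mem := by
    intro t ht
    rcases le_total t L with h | h
    · rw [concat_eqOn_left ⟨ht.1, h⟩]; exact h1.mem _ ⟨ht.1, h⟩
    · rw [concat_eqOn_right h1 h2 ⟨h, ht.2⟩]
      exact h2.mem _ ⟨by linarith, by linarith [ht.2]⟩

/-- A segment contained in `Ω`, parametrized by arc length, is a curve. -/
theorem exists_isCurve_of_segment (h : segment ℝ x y ⊆ Ω) : ∃ L γ, IsCurve Ω x y L γ := by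
  rcases eq_or_ne x y with rfl | hxy
  · exact ⟨0, _, IsCurve.refl (h (left_mem_segment ℝ x x))⟩
  have hpos : 0 < ‖y - x‖ := norm_pos_iff.2 (sub_ne_zero.2 hxy.symm)
  let u : EuclideanSpace ℝ (Fin n) := ‖y - x‖⁻¹ • (y - x)
  have hu : ‖u‖ = 1 := by simp [u, norm_smul, hpos.ne']
  have hiso : Isometry (fun t : ℝ => x + t • u) := Isometry.of_dist_eq fun s t => by
    rw [dist_add_left, dist_eq_norm, ← sub_smul, norm_smul, hu, mul_one, Real.dist_eq,
      Real.norm_eq_abs]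
  refine ⟨‖y - x‖, fun t => x + t • u, hpos.le, ?_, by simp, ?_, ?_⟩
  · refine hasConstantSpeedOnWith_iff_ordered.2 fun s hs t ht hst => le_antisymm ?_ ?_
    · have h1 := (hiso.lipschitz.lipschitzOnWith (s := univ)).comp_eVariationOn_le (g := id)
        (s := Icc 0 ‖y - x‖ ∩ Icc s t) (mapsTo_univ _ _)
      have h2 : eVariationOn (id : ℝ → ℝ) (Icc 0 ‖y - x‖ ∩ Icc s t) ≤ ENNReal.ofReal (t - s) := by
        simpa using ((monotone_id.monotoneOn (Icc 0 ‖y - x‖)).eVariationOn_eq hs ht).le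
      simpa using h1.trans (by simpa using h2)
    · have h1 := eVariationOn.edist_le (fun t : ℝ => x + t • u)
        (s := Icc 0 ‖y - x‖ ∩ Icc s t) (x := s) (y := t) ⟨hs, le_rfl, hst⟩ ⟨ht, hst, le_rfl⟩
      refine le_trans (le_of_eq ?_) h1
      rw [hiso.edist_eq, edist_dist, Real.dist_eq, abs_sub_comm, abs_of_nonneg (sub_nonneg.2 hst)]
      simp
  · simp [u, smul_smul, hpos.ne']
  · intro t ht
    apply h
    rw [segment_eq_image']
    refine ⟨t * ‖y - x‖⁻¹, ⟨mul_nonneg ht.1 (inv_nonneg.2 hpos.le), ?_⟩, ?_⟩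
    · rw [← div_eq_mul_inv]; exact div_le_one_of_le₀ ht.2 hpos.le
    · simp [u, smul_smul]

/-- Any two points of an open connected set are joined by a rectifiable curve in it. -/
theorem exists_isCurve (ho : IsOpen Ω) (hc : IsConnected Ω) (hx : x ∈ Ω) (hy : y ∈ Ω) :
    ∃ L γ, IsCurve Ω x y L γ := by
  refine hc.isPreconnected.induction₂ (fun x y => ∃ L γ, IsCurve Ω x y L γ) ?_ ?_ ?_ hx hy
  · intro a ha
    obtain ⟨r, hr, hball⟩ := Metric.isOpen_iff.1 ho a ha
    filter_upwards [mem_nhdsWithin_of_mem_nhds (Metric.ball_mem_nhds a hr)] with b hb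
    exact exists_isCurve_of_segment
      (((convex_ball a r).segment_subset (Metric.mem_ball_self hr) hb).trans hball)
  · rintro a b c _ _ _ ⟨L, γ, h1⟩ ⟨M, η, h2⟩
    exact ⟨_, _, h1.trans h2⟩
  · rintro a b _ _ ⟨L, γ, h1⟩
    exact ⟨_, _, h1.reverse⟩

end Curves

/-! ### Domains, densities and the metric `d_ρ` -/

/-- A domain in `ℝⁿ`: a nonempty, open, connected set. -/
structure EuclideanDomainSet (n : ℕ) where
  carrier : Set (EuclideanSpace ℝ (Fin n))
  isOpen : IsOpen carrier
  isConnected : IsConnected carrier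

/-- A continuous function `ρ : Ω → (0, ∞)`; its values outside `Ω` play no role. -/
structure Density {n : ℕ} (Ω : EuclideanDomainSet n) where
  toFun : EuclideanSpace ℝ (Fin n) → ℝ
  continuousOn : ContinuousOn toFun Ω.carrier
  pos : ∀ x ∈ Ω.carrier, 0 < toFun x

variable {n : ℕ} {Ω : EuclideanDomainSet n}

/-- The constant density `1`. -/
def Density.one (Ω : EuclideanDomainSet n) : Density Ω where
  toFun := fun _ => 1
  continuousOn := continuousOn_const
  pos := fun _ _ => one_pos

/-- The `ρ`-length `∫_γ ρ |dz|` of an arc-length parametrized curve `γ` of length `L`. -/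
def rhoLength (ρ : Density Ω) (L : ℝ) (γ : ℝ → EuclideanSpace ℝ (Fin n)) : ℝ :=
  ∫ t in (0 : ℝ)..L, ρ.toFun (γ t)

/-- The set of `ρ`-lengths of all curves in `Ω` joining `x` to `y`. -/
def rhoLengths (ρ : Density Ω) (x y : EuclideanSpace ℝ (Fin n)) : Set ℝ :=
  {l | ∃ L γ, IsCurve Ω.carrier x y L γ ∧ rhoLength ρ L γ = l}

/-- For the density `1` the `ρ`-length is the Euclidean length. -/
theorem rhoLength_one (L : ℝ) (γ : ℝ → EuclideanSpace ℝ (Fin n)) :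
    rhoLength (Density.one Ω) L γ = L := by
  simp [rhoLength, Density.one]

theorem continuousOn_rho (ρ : Density Ω) {x y : EuclideanSpace ℝ (Fin n)} {L : ℝ}
    {γ : ℝ → EuclideanSpace ℝ (Fin n)} (h : IsCurve Ω.carrier x y L γ) :
    ContinuousOn (fun t => ρ.toFun (γ t)) (Icc 0 L) :=
  ρ.continuousOn.comp h.continuousOn h.mem

theorem rhoLength_nonneg (ρ : Density Ω) {x y : EuclideanSpace ℝ (Fin n)} {L : ℝ}
    {γ : ℝ → EuclideanSpace ℝ (Fin n)} (h : IsCurve Ω.carrier x y L γ) :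
    0 ≤ rhoLength ρ L γ :=
  intervalIntegral.integral_nonneg h.nonneg fun t ht => (ρ.pos _ (h.mem t ht)).le

theorem rhoLengths_bddBelow (ρ : Density Ω) (x y : EuclideanSpace ℝ (Fin n)) :
    BddBelow (rhoLengths ρ x y) := by
  refine ⟨0, ?_⟩
  rintro _ ⟨L, γ, h, rfl⟩
  exact rhoLength_nonneg ρ h

theorem rhoLengths_nonempty (ρ : Density Ω) {x y : EuclideanSpace ℝ (Fin n)}
    (hx : x ∈ Ω.carrier) (hy : y ∈ Ω.carrier) : (rhoLengths ρ x y).Nonempty := by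
  obtain ⟨L, γ, h⟩ := exists_isCurve Ω.isOpen Ω.isConnected hx hy
  exact ⟨_, L, γ, h, rfl⟩

theorem rhoLengths_symm (ρ : Density Ω) (x y : EuclideanSpace ℝ (Fin n)) :
    rhoLengths ρ x y ⊆ rhoLengths ρ y x := by
  rintro _ ⟨L, γ, h, rfl⟩
  refine ⟨L, _, h.reverse, ?_⟩
  have := intervalIntegral.integral_comp_sub_left (a := 0) (b := L)
    (fun t => ρ.toFun (γ t)) L
  simpa [rhoLength] using this

theorem rhoLength_concat (ρ : Density Ω) {x y z : EuclideanSpace ℝ (Fin n)} {L M : ℝ}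
    {γ η : ℝ → EuclideanSpace ℝ (Fin n)} (h1 : IsCurve Ω.carrier x y L γ)
    (h2 : IsCurve Ω.carrier y z M η) :
    rhoLength ρ (L + M) (concat L γ η) = rhoLength ρ L γ + rhoLength ρ M η := by
  have hc := continuousOn_rho ρ (h1.trans h2)
  have hM := h2.nonneg
  have hL := h1.nonneg
  have hi1 : IntervalIntegrable (fun t => ρ.toFun (concat L γ η t)) volume 0 L :=
    ContinuousOn.intervalIntegrable_of_Icc hL (hc.mono (Icc_subset_Icc_right (by linarith)))
  have hi2 : IntervalIntegrable (fun t => ρ.toFun (concat L γ η t)) volume L (L + M) :=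
    ContinuousOn.intervalIntegrable_of_Icc (by linarith) (hc.mono (Icc_subset_Icc_left hL))
  unfold rhoLength
  rw [← intervalIntegral.integral_add_adjacent_intervals hi1 hi2]
  congr 1
  · refine intervalIntegral.integral_congr fun t ht => ?_
    rw [uIcc_of_le hL] at ht
    simp only [concat_eqOn_left ht]
  · have := intervalIntegral.integral_comp_sub_right (a := L) (b := L + M)
      (fun t => ρ.toFun (η t)) L
    simp only [sub_self, add_sub_cancel_left] at this
    rw [← this]
    refine intervalIntegral.integral_congr fun t ht => ?_
    rw [uIcc_of_le (by linarith)] at ht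
    simp only [concat_eqOn_right h1 h2 ht]

/-- The set `Ω`, to be equipped with the metric `d_ρ`. -/
def RhoSpace (Ω : EuclideanDomainSet n) (_ρ : Density Ω) : Type :=
  {x : EuclideanSpace ℝ (Fin n) // x ∈ Ω.carrier}

/-- The metric `d_ρ(x, y) = inf_γ ℓ_ρ(γ)`, the infimum over all curves joining `x` to `y` in `Ω`. -/
instance RhoSpace.instPseudoMetricSpace (ρ : Density Ω) : PseudoMetricSpace (RhoSpace Ω ρ) where
  dist x y := sInf (rhoLengths ρ x.1 y.1)
  dist_self x := by
    refine le_antisymm (csInf_le (rhoLengths_bddBelow ρ _ _) ?_) (Real.sInf_nonneg ?_)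
    · exact ⟨0, _, IsCurve.refl x.2, by simp [rhoLength]⟩
    · rintro _ ⟨L, γ, h, rfl⟩
      exact rhoLength_nonneg ρ h
  dist_comm x y := by
    have : rhoLengths ρ x.1 y.1 = rhoLengths ρ y.1 x.1 :=
      (rhoLengths_symm ρ _ _).antisymm (rhoLengths_symm ρ _ _)
    simp only [this]
  dist_triangle x y z := by
    have hxy := rhoLengths_nonempty ρ x.2 y.2
    have hyz := rhoLengths_nonempty ρ y.2 z.2
    refine le_of_forall_pos_le_add fun ε hε => ?_
    obtain ⟨_, ⟨L, γ, h1, rfl⟩, h1'⟩ := Real.lt_sInf_add_pos hxy (half_pos hε)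
    obtain ⟨_, ⟨M, η, h2, rfl⟩, h2'⟩ := Real.lt_sInf_add_pos hyz (half_pos hε)
    have h3 := csInf_le (rhoLengths_bddBelow ρ x.1 z.1)
      ⟨L + M, _, h1.trans h2, rhoLength_concat ρ h1 h2⟩
    linarith

/-- The completion of `(Ω, d_ρ)`. -/
abbrev RhoClosure (Ω : EuclideanDomainSet n) (ρ : Density Ω) : Type :=
  UniformSpace.Completion (RhoSpace Ω ρ)

/-- The `ρ`-boundary `∂_ρ Ω`: the completion of `(Ω, d_ρ)` minus `Ω`. -/
def rhoBoundary (Ω : EuclideanDomainSet n) (ρ : Density Ω) : Set (RhoClosure Ω ρ) :=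
  (range (fun y : RhoSpace Ω ρ => (y : RhoClosure Ω ρ)))ᶜ

/-- `Ω` with the internal metric `d(x, y) = inf_γ ℓ(γ)`, which is `d_ρ` for `ρ ≡ 1`. -/
abbrev InternalSpace (Ω : EuclideanDomainSet n) : Type := RhoSpace Ω (Density.one Ω)

/-- The completion of `(Ω, d)`. -/
abbrev InternalClosure (Ω : EuclideanDomainSet n) : Type := RhoClosure Ω (Density.one Ω)

/-- The internal boundary: the completion of `(Ω, d)` minus `Ω`. -/
abbrev internalBoundary (Ω : EuclideanDomainSet n) : Set (InternalClosure Ω) :=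
  rhoBoundary Ω (Density.one Ω)

/-- The internal distance is the infimum of the Euclidean lengths of the curves joining `x` to `y`
in `Ω`. -/
theorem internal_dist_eq (x y : InternalSpace Ω) :
    dist x y = sInf {L | ∃ γ, IsCurve Ω.carrier x.1 y.1 L γ} := by
  change sInf (rhoLengths _ _ _) = _
  simp only [rhoLengths, rhoLength_one]
  congr 1
  ext L
  constructor
  · rintro ⟨_, γ, h, rfl⟩; exact ⟨γ, h⟩
  · rintro ⟨γ, h⟩; exact ⟨L, γ, h, rfl⟩

/-- `d(x)`: the Euclidean distance from `x` to the boundary of `Ω`. -/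
def bdist (Ω : EuclideanDomainSet n) (x : EuclideanSpace ℝ (Fin n)) : ℝ :=
  Metric.infDist x (frontier Ω.carrier)

/-- `Ω` is a John domain: for some `0 < α ≤ 1` and some `x₀ ∈ Ω`, every `x ∈ Ω` is joined to `x₀`
in `Ω` by an arc-length parametrized curve `γ`, starting at `x`, with `d(γ(t)) ≥ α t` for all
`0 ≤ t ≤ ℓ(γ)`. -/
def IsJohn (Ω : EuclideanDomainSet n) : Prop :=
  ∃ α : ℝ, 0 < α ∧ α ≤ 1 ∧ ∃ x₀ ∈ Ω.carrier, ∀ x ∈ Ω.carrier, ∃ L γ,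
    IsCurve Ω.carrier x x₀ L γ ∧ ∀ t ∈ Icc 0 L, α * t ≤ bdist Ω (γ t)

/-! ### Packing measure and packing dimension -/

section Packing

variable {X : Type*} [PseudoMetricSpace X]

/-- `t` encodes a packing `{B(x, r) : (x, r) ∈ t}` of `A` with radii at most `ε`: a pairwise
disjoint family of open balls of `X` with centres in `A`. -/
structure IsPacking (A : Set X) (ε : ℝ) (t : Set (X × ℝ)) : Prop where
  center_mem : ∀ p ∈ t, p.1 ∈ A
  radius_pos : ∀ p ∈ t, 0 < p.2
  radius_le : ∀ p ∈ t, p.2 ≤ ε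
  disjoint : t.PairwiseDisjoint fun p => Metric.ball p.1 p.2

/-- `P^{s,ε}(A) = sup ∑ rᵢ ^ s` over all packings of `A` with radii at most `ε`. -/
def prePackingAux (s ε : ℝ) (A : Set X) : ℝ≥0∞ :=
  ⨆ (t : Set (X × ℝ)) (_ : IsPacking A ε t), ∑' p : t, ENNReal.ofReal p.1.2 ^ s

/-- `P^s(A) = lim_{ε ↓ 0} P^{s,ε}(A)`; the limit is an infimum, by monotonicity in `ε`. -/
def prePacking (s : ℝ) (A : Set X) : ℝ≥0∞ :=
  ⨅ (ε : ℝ) (_ : 0 < ε), prePackingAux s ε A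

/-- The `s`-dimensional packing measure of `A`. -/
def packingMeasure (s : ℝ) (A : Set X) : ℝ≥0∞ :=
  ⨅ (B : ℕ → Set X) (_ : A ⊆ ⋃ i, B i), ∑' i, prePacking s (B i)

/-- The packing dimension of `A`. -/
def packingDim (A : Set X) : ℝ≥0∞ :=
  ⨆ (s : ℝ≥0) (_ : packingMeasure (s : ℝ) A = ∞), (s : ℝ≥0∞)

end Packing

end DensityMetric

end

open DensityMetric

/-! Since `ρ > c`, the identity `(Ω, d_ρ) → (Ω, d)` is Lipschitz and extends to `closureMap` between
the completions. Both metrics induce the Euclidean topology on `Ω`, so `closureMap` sends `∂_ρ Ω`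
into `∂_d Ω`. The theorem holds because this boundary map is onto and locally bi-Hölder, with
exponents as close to `1 + i(x)` as desired.

Let `a < i(x) < b`, so that `d(y)^b ≲ ρ(y) ≲ d(y)^a` near `x`; the bound `ρ > c` forces `i ≤ 0`, and
`b` may be replaced by `min b 0`. Lower bound (`mul_rpow_le_rhoClosure_dist`): the first stretch of
length `δ` of a curve leaving a boundary point stays within `δ` of the boundary, where `ρ ≳ δ^b`, so
it costs at least a multiple of `δ^(1+b)`.

Upper bound (`exists_rhoDist_le_rpow`), where the John condition enters: for `y, z` at internal
distance `δ`, every point of an almost shortest curve between them is moved along its John curve to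
depth comparable to `δ`. This costs a multiple of `δ^(1+a)`, because `t^a` is integrable at `0`. The
deep points lie in boundedly many Euclidean balls of radius comparable to `δ` on which `ρ ≲ δ^a`, so
a chain of bounded length joins `y` to `z`. The estimate also makes `closureMap` onto `∂_d Ω`.

`dim_eq_iSup_of_local_holder` turns these local estimates into the formula. It uses only
monotonicity, countable stability and Hölder distortion, and hence serves both dimensions. -/

namespace DensityMetric

/-! ### Packing and Hausdorff dimension: countable stability and Hölder distortion. -/

section Dimension

variable {X Y : Type*} [PseudoMetricSpace X] [PseudoMetricSpace Y]

theorem prePackingAux_mono_radius {s ε δ : ℝ} {A : Set X} (h : ε ≤ δ) :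
    prePackingAux s ε A ≤ prePackingAux s δ A :=
  iSup_mono fun _ => iSup_mono' fun ht =>
    ⟨⟨ht.center_mem, ht.radius_pos, fun p hp => (ht.radius_le p hp).trans h, ht.disjoint⟩, le_rfl⟩

theorem packingMeasure_mono {s : ℝ} {A B : Set X} (h : A ⊆ B) :
    packingMeasure s A ≤ packingMeasure s B :=
  iInf_mono fun _ => iInf_mono' fun hB => ⟨h.trans hB, le_rfl⟩

theorem packingDim_mono {A B : Set X} (h : A ⊆ B) : packingDim A ≤ packingDim B :=
  iSup_mono fun _ => iSup_mono' fun hs =>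
    ⟨top_le_iff.1 (hs.ge.trans (packingMeasure_mono h)), le_rfl⟩

/-- Covers of the pieces with summable small premeasure are merged into one by the pairing function.
Null sets suffice for the stability of the dimension. -/
theorem packingMeasure_iUnion_eq_zero {s : ℝ} {A : ℕ → Set X}
    (h : ∀ k, packingMeasure s (A k) = 0) : packingMeasure s (⋃ k, A k) = 0 := by
  refine le_antisymm (ENNReal.le_of_forall_pos_le_add fun ε hε _ => ?_) zero_le
  obtain ⟨δ, hδ, hsum⟩ := ENNReal.exists_pos_sum_of_countable' (ENNReal.coe_pos.2 hε).ne' ℕ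
  have hB : ∀ k, ∃ B : ℕ → Set X, A k ⊆ ⋃ i, B i ∧ ∑' i, prePacking s (B i) < δ k := by
    intro k
    have : packingMeasure s (A k) < δ k := by rw [h k]; exact hδ k
    simpa only [packingMeasure, iInf_lt_iff, exists_prop] using this
  choose B hB1 hB2 using hB
  rw [zero_add]
  refine le_trans (iInf₂_le (fun m => B (Nat.unpair m).1 (Nat.unpair m).2) ?_) ?_
  · refine iUnion_subset fun k x hx => ?_
    obtain ⟨i, hi⟩ := mem_iUnion.1 (hB1 k hx)
    exact mem_iUnion.2 ⟨Nat.pair k i, by simpa using hi⟩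
  · have h1 := Nat.pairEquiv.symm.tsum_eq (fun p : ℕ × ℕ => prePacking s (B p.1 p.2))
    have h2 : ∑' m : ℕ, prePacking s (B (Nat.unpair m).1 (Nat.unpair m).2)
        = ∑' p : ℕ × ℕ, prePacking s (B p.1 p.2) := h1
    rw [h2, ENNReal.tsum_prod']
    exact (ENNReal.tsum_le_tsum fun k => (hB2 k).le).trans hsum.le

theorem prePackingAux_le_mul {s t ε : ℝ} (hst : s ≤ t) {A : Set X} :
    prePackingAux t ε A ≤ ENNReal.ofReal ε ^ (t - s) * prePackingAux s ε A := by
  refine iSup₂_le fun T hT => ?_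
  calc ∑' p : T, ENNReal.ofReal p.1.2 ^ t
      ≤ ∑' p : T, ENNReal.ofReal ε ^ (t - s) * ENNReal.ofReal p.1.2 ^ s := by
        refine ENNReal.tsum_le_tsum fun p => ?_
        have hp : ENNReal.ofReal p.1.2 ≠ 0 := by simpa using hT.radius_pos p.1 p.2
        have h1 : ENNReal.ofReal p.1.2 ^ t
            = ENNReal.ofReal p.1.2 ^ (t - s) * ENNReal.ofReal p.1.2 ^ s := by
          rw [← ENNReal.rpow_add _ _ hp ENNReal.ofReal_ne_top, sub_add_cancel]
        rw [h1]
        gcongr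
        exact hT.radius_le p.1 p.2
    _ = ENNReal.ofReal ε ^ (t - s) * ∑' p : T, ENNReal.ofReal p.1.2 ^ s := ENNReal.tsum_mul_left
    _ ≤ _ := by gcongr; exact le_iSup₂ (f := fun (T : Set (X × ℝ)) (_ : IsPacking A ε T) =>
        ∑' p : T, ENNReal.ofReal p.1.2 ^ s) T hT

/-- For radii at most `ε` one has `r ^ t ≤ ε ^ (t - s) * r ^ s`, and the factor tends to `0`. -/
theorem prePacking_eq_zero {s t : ℝ} (hst : s < t) {A : Set X}
    (h : prePacking s A ≠ ∞) : prePacking t A = 0 := by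
  obtain ⟨ε₀, hε₀, hlt⟩ : ∃ ε : ℝ, 0 < ε ∧ prePackingAux s ε A < ∞ := by
    simpa only [prePacking, iInf_lt_iff, exists_prop] using h.lt_top
  have hlim : Tendsto (fun ε : ℝ => ENNReal.ofReal ε ^ (t - s) * prePackingAux s ε₀ A)
      (𝓝[>] 0) (𝓝 0) := by
    have h1 : Tendsto (fun ε : ℝ => ENNReal.ofReal ε ^ (t - s)) (𝓝[>] 0) (𝓝 0) := by
      have : Continuous (fun ε : ℝ => ENNReal.ofReal ε ^ (t - s)) :=
        (ENNReal.continuous_rpow_const).comp ENNReal.continuous_ofReal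
      have h2 := (this.tendsto 0).mono_left (nhdsWithin_le_nhds (s := Ioi 0))
      simpa [ENNReal.zero_rpow_of_pos (sub_pos.2 hst)] using h2
    simpa using ENNReal.Tendsto.mul_const h1 (Or.inr hlt.ne)
  refine le_antisymm (ge_of_tendsto hlim ?_) zero_le
  filter_upwards [Ioc_mem_nhdsGT hε₀] with ε hε
  refine (iInf₂_le ε hε.1).trans ((prePackingAux_le_mul hst.le).trans ?_)
  gcongr
  exact prePackingAux_mono_radius hε.2

theorem packingMeasure_eq_zero {s t : ℝ} (hst : s < t) {A : Set X}
    (h : packingMeasure s A ≠ ∞) : packingMeasure t A = 0 := by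
  obtain ⟨B, hB, hlt⟩ : ∃ B : ℕ → Set X, A ⊆ ⋃ i, B i ∧ ∑' i, prePacking s (B i) < ∞ := by
    simpa only [packingMeasure, iInf_lt_iff, exists_prop] using h.lt_top
  refine le_antisymm ((iInf₂_le B hB).trans ?_) zero_le
  rw [nonpos_iff_eq_zero, ENNReal.tsum_eq_zero]
  exact fun i => prePacking_eq_zero hst (ENNReal.ne_top_of_tsum_ne_top hlt.ne i)

theorem packingDim_iUnion_le {A : ℕ → Set X} {D : ℝ≥0∞} (h : ∀ k, packingDim (A k) ≤ D) :
    packingDim (⋃ k, A k) ≤ D := by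
  refine iSup₂_le fun t ht => le_of_not_gt fun hlt => ?_
  obtain ⟨s, hs1, hs2⟩ := ENNReal.lt_iff_exists_nnreal_btwn.1 hlt
  have hst : (s : ℝ) < t := by exact_mod_cast hs2
  have : packingMeasure (t : ℝ) (⋃ k, A k) = 0 := by
    refine packingMeasure_iUnion_eq_zero fun k => packingMeasure_eq_zero hst fun htop => ?_
    exact absurd ((le_iSup₂ (f := fun (s : ℝ≥0) (_ : packingMeasure (s : ℝ) (A k) = ∞) =>
      (s : ℝ≥0∞)) s htop).trans (h k)) (not_le.2 hs1)
  rw [this] at ht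
  exact ENNReal.zero_ne_top ht

theorem packingDim_empty : packingDim (∅ : Set X) = 0 := by
  refine le_antisymm (iSup₂_le fun s hs => ?_) zero_le
  have h0 : prePacking (s : ℝ) (∅ : Set X) = 0 := by
    refine le_antisymm ((iInf₂_le 1 one_pos).trans (iSup₂_le fun T hT => ?_)) zero_le
    obtain rfl : T = ∅ := eq_empty_of_forall_notMem fun p hp => hT.center_mem p hp
    simp
  have h1 : packingMeasure (s : ℝ) (∅ : Set X) ≤ ∑' _ : ℕ, prePacking (s : ℝ) (∅ : Set X) :=
    iInf₂_le (fun _ : ℕ => (∅ : Set X)) (Set.empty_subset _)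
  rw [hs, h0, tsum_zero] at h1
  exact absurd h1 (by simp)

theorem packingDim_biUnion_le {ι : Type*} {T : Set ι} (hT : T.Countable) {A : ι → Set X}
    {D : ℝ≥0∞} (h : ∀ k ∈ T, packingDim (A k) ≤ D) : packingDim (⋃ k ∈ T, A k) ≤ D := by
  rcases T.eq_empty_or_nonempty with rfl | hne
  · simp [packingDim_empty]
  · obtain ⟨f, rfl⟩ := hT.exists_eq_range hne
    rw [biUnion_range]
    exact packingDim_iUnion_le fun k => h _ (mem_range_self k)

/-- In a general metric space disjointness of balls does not bound the sum of the radii by the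
distance of the centres; it only keeps each centre out of the other ball. -/
theorem IsPacking.max_le_dist {A : Set X} {ε : ℝ} {t : Set (X × ℝ)} (ht : IsPacking A ε t)
    {p q : X × ℝ} (hp : p ∈ t) (hq : q ∈ t) (hpq : p ≠ q) : max p.2 q.2 ≤ dist p.1 q.1 := by
  have hd := Set.disjoint_left.1 (ht.disjoint hp hq hpq)
  refine max_le (le_of_not_gt fun h => ?_) (le_of_not_gt fun h => ?_)
  · exact hd (a := q.1) (by simpa [dist_comm] using h)
      (Metric.mem_ball_self (ht.radius_pos q hq))
  · exact hd (a := p.1) (Metric.mem_ball_self (ht.radius_pos p hp)) (by simpa using h)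

/-- A ball of radius `r` about `p` is replaced by one of radius `c * r ^ a⁻¹` about `g p`. The
factor `1 / 2` in `c` makes each new radius at most half the distance of the new centres, so the new
balls are disjoint although only the larger of two old radii is controlled. -/
theorem prePacking_le_of_holder {s : Set X} {t : Set Y} {g : X → Y} (hg : MapsTo g s t)
    {C a σ : ℝ} (hC : 0 < C) (ha : 0 < a)
    (hd : ∀ x ∈ s, ∀ y ∈ s, dist x y ≤ C * dist (g x) (g y) ^ a) :
    prePacking σ s ≤
      ENNReal.ofReal ((C ^ (-a⁻¹) / 2) ^ (-(a * σ))) * prePacking (a * σ) t := by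
  set c : ℝ := C ^ (-a⁻¹) / 2 with hc
  have hc0 : 0 < c := by positivity
  set K := ENNReal.ofReal (c ^ (-(a * σ))) with hK
  have hK0 : K ≠ 0 := by
    have : 0 < c ^ (-(a * σ)) := by positivity
    simpa [hK] using this
  conv_rhs => rw [prePacking]
  simp only [ENNReal.mul_iInf_of_ne hK0 ENNReal.ofReal_ne_top]
  refine le_iInf₂ fun ε hε => ?_
  refine (iInf₂_le ((ε / c) ^ a) (by positivity)).trans (iSup₂_le fun T hT => ?_)
  let φ : X × ℝ → Y × ℝ := fun p => (g p.1, c * p.2 ^ a⁻¹)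
  have key : ∀ p ∈ T, ∀ q ∈ T, p ≠ q →
      c * p.2 ^ a⁻¹ + c * q.2 ^ a⁻¹ ≤ dist (g p.1) (g q.1) := by
    intro p hp q hq hpq
    have hm := hT.max_le_dist hp hq hpq
    have h1 := hd _ (hT.center_mem p hp) _ (hT.center_mem q hq)
    have main : ∀ r : ℝ, 0 < r → r ≤ dist p.1 q.1 → c * r ^ a⁻¹ ≤ dist (g p.1) (g q.1) / 2 := by
      intro r hr hrd
      have h2 : C⁻¹ * r ≤ dist (g p.1) (g q.1) ^ a := by
        rw [inv_mul_le_iff₀ hC]; exact hrd.trans h1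
      have h3 := Real.rpow_le_rpow (by positivity) h2 (inv_nonneg.2 ha.le)
      rw [Real.rpow_rpow_inv dist_nonneg ha.ne', Real.mul_rpow (by positivity) hr.le,
        Real.inv_rpow hC.le, ← Real.rpow_neg hC.le] at h3
      rw [hc]; linarith
    have := main p.2 (hT.radius_pos p hp) ((le_max_left _ _).trans hm)
    have := main q.2 (hT.radius_pos q hq) ((le_max_right _ _).trans hm)
    linarith
  have hpos : ∀ p ∈ T, 0 < c * p.2 ^ a⁻¹ := fun p hp => by
    have := hT.radius_pos p hp; positivity
  have hinj : InjOn φ T := by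
    intro p hp q hq h
    by_contra hpq
    have h1 := key p hp q hq hpq
    rw [show g p.1 = g q.1 from congrArg Prod.fst h, dist_self] at h1
    linarith [hpos p hp, hpos q hq]
  have hpack : IsPacking t ε (φ '' T) := by
    refine ⟨?_, ?_, ?_, ?_⟩
    · rintro _ ⟨p, hp, rfl⟩; exact hg (hT.center_mem p hp)
    · rintro _ ⟨p, hp, rfl⟩; exact hpos p hp
    · rintro _ ⟨p, hp, rfl⟩
      have h1 := Real.rpow_le_rpow (hT.radius_pos p hp).le (hT.radius_le p hp)
        (inv_nonneg.2 ha.le)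
      rw [Real.rpow_rpow_inv (by positivity) ha.ne', le_div_iff₀' hc0] at h1
      exact h1
    · rintro _ ⟨p, hp, rfl⟩ _ ⟨q, hq, rfl⟩ hne
      exact Metric.ball_disjoint_ball (key p hp q hq fun h => hne (by rw [h]))
  have hsum : ∑' p : T, ENNReal.ofReal p.1.2 ^ σ
      = K * ∑' q : φ '' T, ENNReal.ofReal q.1.2 ^ (a * σ) := by
    rw [tsum_image (fun q : Y × ℝ => ENNReal.ofReal q.2 ^ (a * σ)) hinj, ← ENNReal.tsum_mul_left]
    refine tsum_congr fun p => ?_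
    have hp := hT.radius_pos p.1 p.2
    rw [hK, ENNReal.ofReal_rpow_of_pos hp, ENNReal.ofReal_rpow_of_pos (hpos _ p.2),
      ← ENNReal.ofReal_mul (by positivity), Real.mul_rpow hc0.le (by positivity),
      ← Real.rpow_mul hp.le, ← mul_assoc, ← Real.rpow_add hc0, neg_add_cancel, Real.rpow_zero,
      one_mul, inv_mul_cancel_left₀ ha.ne']
  rw [hsum]
  gcongr
  exact le_iSup₂ (f := fun (T : Set (Y × ℝ)) (_ : IsPacking t ε T) =>
        ∑' p : T, ENNReal.ofReal p.1.2 ^ (a * σ)) _ hpack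

theorem packingDim_le_of_holder {s : Set X} {t : Set Y} {g : X → Y} (hg : MapsTo g s t)
    {C a : ℝ} (hC : 0 < C) (ha : 0 < a)
    (hd : ∀ x ∈ s, ∀ y ∈ s, dist x y ≤ C * dist (g x) (g y) ^ a) :
    packingDim s ≤ packingDim t / ENNReal.ofReal a := by
  refine iSup₂_le fun σ hσ => ?_
  have ha' : ENNReal.ofReal a ≠ 0 := by simpa using ha
  rw [ENNReal.le_div_iff_mul_le (Or.inl ha') (Or.inl ENNReal.ofReal_ne_top)]
  have htop : packingMeasure (a * σ) t = ∞ := by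
    by_contra hne
    obtain ⟨B, hB, hlt⟩ : ∃ B : ℕ → Set Y, t ⊆ ⋃ i, B i ∧ ∑' i, prePacking (a * σ) (B i) < ∞ := by
      simpa only [packingMeasure, iInf_lt_iff, exists_prop] using (Ne.lt_top hne)
    have h1 : packingMeasure (σ : ℝ) s ≤ ∑' i, prePacking (σ : ℝ) (s ∩ g ⁻¹' B i) := by
      refine iInf₂_le _ fun x hx => ?_
      obtain ⟨i, hi⟩ := mem_iUnion.1 (hB (hg hx))
      exact mem_iUnion.2 ⟨i, hx, hi⟩
    have h2 := h1.trans (ENNReal.tsum_le_tsum fun i =>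
      prePacking_le_of_holder (s := s ∩ g ⁻¹' B i) (t := B i) (g := g) (fun x hx => hx.2) hC ha
        fun x hx y hy => hd x hx.1 y hy.1)
    rw [hσ, ENNReal.tsum_mul_left] at h2
    exact (ENNReal.mul_lt_top ENNReal.ofReal_lt_top hlt).not_ge h2
  refine le_trans (le_of_eq ?_) (le_iSup₂ (f := fun (s : ℝ≥0) (_ : packingMeasure (s : ℝ) t = ∞) =>
      (s : ℝ≥0∞)) (a.toNNReal * σ) (by simpa [Real.coe_toNNReal _ ha.le] using htop))
  rw [ENNReal.coe_mul, mul_comm]; rfl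

end Dimension

/-- The hypothesis makes `g` injective on `s` with an `a`-Hölder inverse, and Hölder maps divide the
dimension by at most their exponent. -/
theorem dimH_le_of_holder {X Y : Type*} [MetricSpace X] [MetricSpace Y] {s : Set X} {t : Set Y}
    {g : X → Y} (hg : MapsTo g s t) {C a : ℝ} (hC : 0 < C) (ha : 0 < a)
    (hd : ∀ x ∈ s, ∀ y ∈ s, dist x y ≤ C * dist (g x) (g y) ^ a) :
    dimH s ≤ dimH t / ENNReal.ofReal a := by
  rcases s.eq_empty_or_nonempty with rfl | ⟨x₀, hx₀⟩
  · simp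
  have hinj : InjOn g s := by
    intro x hx y hy h
    have := hd x hx y hy
    rw [h, dist_self, Real.zero_rpow ha.ne', mul_zero] at this
    exact dist_le_zero.1 this
  have : Nonempty X := ⟨x₀⟩
  have hinv : ∀ x ∈ s, Function.invFunOn g s (g x) = x := fun x hx =>
    hinj.leftInvOn_invFunOn hx
  have hol : HolderOnWith C.toNNReal a.toNNReal (Function.invFunOn g s) (g '' s) := by
    rintro _ ⟨x, hx, rfl⟩ _ ⟨y, hy, rfl⟩
    rw [hinv x hx, hinv y hy, edist_dist, edist_dist, Real.coe_toNNReal _ ha.le,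
      ENNReal.ofReal_rpow_of_nonneg dist_nonneg ha.le]
    change _ ≤ ENNReal.ofReal C * _
    rw [← ENNReal.ofReal_mul hC.le]
    exact ENNReal.ofReal_le_ofReal (hd x hx y hy)
  have h1 := hol.dimH_image_le (Real.toNNReal_pos.2 ha)
  have himg : Function.invFunOn g s '' (g '' s) = s := by
    rw [image_image]
    exact (image_congr fun x hx => hinv x hx).trans (image_id' s)
  rw [himg] at h1
  exact h1.trans (ENNReal.div_le_div_right (dimH_mono (image_subset_iff.2 hg)) _)

variable {n : ℕ} {Ω : EuclideanDomainSet n}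

/-! ### Subcurves and segments. -/

section Curves

variable {U : Set (EuclideanSpace ℝ (Fin n))} {x y : EuclideanSpace ℝ (Fin n)}
  {L : ℝ} {γ : ℝ → EuclideanSpace ℝ (Fin n)}

theorem IsCurve.restrict (h : IsCurve U x y L γ) {a b : ℝ} (ha : 0 ≤ a) (hab : a ≤ b)
    (hb : b ≤ L) : IsCurve U (γ a) (γ b) (b - a) (fun t => γ (t + a)) where
  nonneg := sub_nonneg.2 hab
  arclength := by
    have h1 : HasUnitSpeedOn γ (Icc (0 + a) (b - a + a)) := by
      intro u hu v hv
      have hu' : u ∈ Icc a b := by simpa using hu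
      have hv' : v ∈ Icc a b := by simpa using hv
      rw [← h.arclength ⟨ha.trans hu'.1, hu'.2.trans hb⟩
        ⟨ha.trans hv'.1, hv'.2.trans hb⟩]
      congr 1
      rw [Icc_inter_Icc, Icc_inter_Icc]
      simp [hu'.1, hv'.2, ha.trans hu'.1, hv'.2.trans hb]
    have h2 := hasUnitSpeedOn_comp_affine_iff (f := fun t => γ (t + a)) (a := 0) (b := b - a)
      (c := a)
    simp only [sub_add_cancel] at h2 h1
    exact h2.1 h1
  source := by simp
  target := by simp
  mem := fun t ht => h.mem _ ⟨by linarith [ht.1], by linarith [ht.2]⟩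

theorem IsCurve.dist_le (h : IsCurve U x y L γ) {s t : ℝ} (hs : s ∈ Icc 0 L) (ht : t ∈ Icc 0 L) :
    dist (γ s) (γ t) ≤ |s - t| := by
  simpa [Real.dist_eq] using h.lipschitz.dist_le_mul s hs t ht

theorem IsCurve.dist_endpoints_le (h : IsCurve U x y L γ) : dist x y ≤ L := by
  have := h.dist_le ⟨le_rfl, h.nonneg⟩ ⟨h.nonneg, le_rfl⟩
  rwa [h.source, h.target, zero_sub, abs_neg, abs_of_nonneg h.nonneg] at this

/-- A segment in `U` is a curve whose length is the distance of its endpoints. -/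
theorem exists_isCurve_dist_of_segment (h : segment ℝ x y ⊆ U) :
    ∃ γ, IsCurve U x y (dist x y) γ := by
  rcases eq_or_ne x y with rfl | hxy
  · exact ⟨_, by simpa using IsCurve.refl (h (left_mem_segment ℝ x x))⟩
  have hpos : 0 < dist x y := dist_pos.2 hxy
  have hnorm : ‖y - x‖ = dist x y := by rw [dist_comm, dist_eq_norm]
  let u : EuclideanSpace ℝ (Fin n) := (dist x y)⁻¹ • (y - x)
  have hu : ‖u‖ = 1 := by
    simp only [u, norm_smul, norm_inv, Real.norm_eq_abs, abs_of_pos hpos, hnorm]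
    exact inv_mul_cancel₀ hpos.ne'
  have hiso : Isometry (fun t : ℝ => x + t • u) := Isometry.of_dist_eq fun s t => by
    rw [dist_add_left, dist_eq_norm, ← sub_smul, norm_smul, hu, mul_one, Real.dist_eq,
      Real.norm_eq_abs]
  refine ⟨fun t => x + t • u, hpos.le, ?_, by simp, ?_, ?_⟩
  · refine hasConstantSpeedOnWith_iff_ordered.2 fun s hs t ht hst => le_antisymm ?_ ?_
    · have h1 := (hiso.lipschitz.lipschitzOnWith (s := univ)).comp_eVariationOn_le (g := id)
        (s := Icc 0 (dist x y) ∩ Icc s t) (mapsTo_univ _ _)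
      have h2 : eVariationOn (id : ℝ → ℝ) (Icc 0 (dist x y) ∩ Icc s t) ≤ ENNReal.ofReal (t - s) := by
        simpa using ((monotone_id.monotoneOn (Icc 0 (dist x y))).eVariationOn_eq hs ht).le
      simpa using h1.trans (by simpa using h2)
    · have h1 := eVariationOn.edist_le (fun t : ℝ => x + t • u)
        (s := Icc 0 (dist x y) ∩ Icc s t) (x := s) (y := t) ⟨hs, le_rfl, hst⟩ ⟨ht, hst, le_rfl⟩
      refine le_trans (le_of_eq ?_) h1
      rw [hiso.edist_eq, edist_dist, Real.dist_eq, abs_sub_comm, abs_of_nonneg (sub_nonneg.2 hst)]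
      simp
  · simp [u, smul_smul, hpos.ne']
  · intro t ht
    apply h
    rw [segment_eq_image']
    refine ⟨t * (dist x y)⁻¹, ⟨mul_nonneg ht.1 (inv_nonneg.2 hpos.le), ?_⟩, ?_⟩
    · rw [← div_eq_mul_inv]; exact div_le_one_of_le₀ ht.2 hpos.le
    · simp [u, smul_smul]

end Curves

/-! ### Comparison of `d_ρ`, the internal metric and the Euclidean metric. -/

section Distance

variable {ρ : Density Ω}

theorem rhoDist_le_of_isCurve (x y : RhoSpace Ω ρ) {L : ℝ} {γ : ℝ → EuclideanSpace ℝ (Fin n)}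
    (h : IsCurve Ω.carrier x.1 y.1 L γ) : dist x y ≤ rhoLength ρ L γ :=
  csInf_le (rhoLengths_bddBelow ρ _ _) ⟨L, γ, h, rfl⟩

theorem le_rhoDist {x y : RhoSpace Ω ρ} {m : ℝ}
    (h : ∀ L γ, IsCurve Ω.carrier x.1 y.1 L γ → m ≤ rhoLength ρ L γ) : m ≤ dist x y := by
  refine le_csInf (rhoLengths_nonempty ρ x.2 y.2) ?_
  rintro _ ⟨L, γ, hγ, rfl⟩
  exact h L γ hγ

theorem internalDist_le_of_isCurve (x y : InternalSpace Ω) {L : ℝ}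
    {γ : ℝ → EuclideanSpace ℝ (Fin n)} (h : IsCurve Ω.carrier x.1 y.1 L γ) : dist x y ≤ L := by
  simpa only [rhoLength_one] using rhoDist_le_of_isCurve x y h

theorem exists_isCurve_of_internalDist_lt {x y : InternalSpace Ω} {r : ℝ} (h : dist x y < r) :
    ∃ L γ, IsCurve Ω.carrier x.1 y.1 L γ ∧ L < r := by
  obtain ⟨_, ⟨L, γ, hγ, rfl⟩, hlt⟩ :=
    exists_lt_of_csInf_lt (rhoLengths_nonempty (Density.one Ω) x.2 y.2) h
  exact ⟨L, γ, hγ, by rwa [rhoLength_one] at hlt⟩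

theorem euclideanDist_le_internalDist (x y : InternalSpace Ω) : dist x.1 y.1 ≤ dist x y :=
  le_rhoDist fun L γ h => by rw [rhoLength_one]; exact h.dist_endpoints_le

theorem rhoLength_le_mul {x y : EuclideanSpace ℝ (Fin n)} {L : ℝ}
    {γ : ℝ → EuclideanSpace ℝ (Fin n)} (h : IsCurve Ω.carrier x y L γ) {M : ℝ}
    (hM : ∀ t ∈ Icc 0 L, ρ.toFun (γ t) ≤ M) : rhoLength ρ L γ ≤ M * L := by
  have h1 := intervalIntegral.integral_mono_on h.nonneg
    ((continuousOn_rho ρ h).intervalIntegrable_of_Icc h.nonneg)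
    (intervalIntegrable_const (μ := volume) (c := M)) hM
  simpa [rhoLength, mul_comm] using h1

theorem mul_le_rhoLength {x y : EuclideanSpace ℝ (Fin n)} {L : ℝ}
    {γ : ℝ → EuclideanSpace ℝ (Fin n)} (h : IsCurve Ω.carrier x y L γ) {m : ℝ}
    (hm : ∀ t ∈ Icc 0 L, m ≤ ρ.toFun (γ t)) : m * L ≤ rhoLength ρ L γ := by
  have h1 := intervalIntegral.integral_mono_on h.nonneg
    (intervalIntegrable_const (μ := volume) (c := m))
    ((continuousOn_rho ρ h).intervalIntegrable_of_Icc h.nonneg) hm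
  simpa [rhoLength, mul_comm] using h1

theorem rhoLength_restrict_le {x y : EuclideanSpace ℝ (Fin n)} {L : ℝ}
    {γ : ℝ → EuclideanSpace ℝ (Fin n)} (h : IsCurve Ω.carrier x y L γ) {r : ℝ} (hr0 : 0 ≤ r)
    (hr : r ≤ L) : rhoLength ρ r γ ≤ rhoLength ρ L γ := by
  refine intervalIntegral.integral_mono_interval le_rfl hr0 hr ?_
    ((continuousOn_rho ρ h).intervalIntegrable_of_Icc h.nonneg)
  refine (ae_restrict_iff' measurableSet_Ioc).2 (Eventually.of_forall fun t ht => ?_)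
  exact (ρ.pos _ (h.mem t ⟨ht.1.le, ht.2⟩)).le

theorem IsCurve.restrict_left {x y : EuclideanSpace ℝ (Fin n)} {U : Set (EuclideanSpace ℝ (Fin n))}
    {L : ℝ} {γ : ℝ → EuclideanSpace ℝ (Fin n)} (h : IsCurve U x y L γ) {r : ℝ} (hr0 : 0 ≤ r)
    (hr : r ≤ L) : IsCurve U x (γ r) r γ := by
  simpa [h.source] using h.restrict le_rfl hr0 hr

/-- The identity map from `Ω` with the Euclidean metric to `(Ω, d_ρ)`. -/
def ofEuclidean (ρ : Density Ω) (x : Ω.carrier) : RhoSpace Ω ρ := ⟨x.1, x.2⟩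

/-- The identity map between the metrics of two densities. -/
def changeDensity (σ : Density Ω) (x : RhoSpace Ω ρ) : RhoSpace Ω σ := ⟨x.1, x.2⟩

/-- The identity map `(Ω, d_ρ) → (Ω, d)`. -/
abbrev toInternal (x : RhoSpace Ω ρ) : InternalSpace Ω := changeDensity (Density.one Ω) x

/-- If `ρ ≥ m` along the initial parts of length `r` of all curves from `x` to `y`, where `r` is
at most the internal distance, then `d_ρ(x, y) ≥ m r`. -/
theorem mul_le_rhoDist {x y : RhoSpace Ω ρ} {r m : ℝ} (hr0 : 0 ≤ r)
    (hr : ∀ L γ, IsCurve Ω.carrier x.1 y.1 L γ → r ≤ L)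
    (hm : ∀ z : InternalSpace Ω, dist (toInternal x) z ≤ r → m ≤ ρ.toFun z.1) :
    m * r ≤ dist x y := by
  refine le_rhoDist fun L γ h => ?_
  have hL := hr L γ h
  refine (mul_le_rhoLength (h.restrict_left hr0 hL) fun t ht => ?_).trans
    (rhoLength_restrict_le h hr0 hL)
  have h1 := h.restrict_left ht.1 (ht.2.trans hL)
  exact hm (ofEuclidean _ ⟨γ t, h.mem t ⟨ht.1, ht.2.trans hL⟩⟩)
    ((internalDist_le_of_isCurve (toInternal x) (ofEuclidean _ ⟨γ t, _⟩) h1).trans ht.2)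

theorem exists_local_bound (ρ : Density Ω) {z : EuclideanSpace ℝ (Fin n)} (hz : z ∈ Ω.carrier) :
    ∃ r > 0, ∃ M > 0, Metric.ball z r ⊆ Ω.carrier ∧ ∀ w ∈ Metric.ball z r, ρ.toFun w ≤ M := by
  have hc : ContinuousAt ρ.toFun z := ρ.continuousOn.continuousAt (Ω.isOpen.mem_nhds hz)
  have h1 : ∀ᶠ w in 𝓝 z, ρ.toFun w < ρ.toFun z + 1 := hc.eventually_lt_const (by linarith)
  obtain ⟨r, hr, h2⟩ := Metric.eventually_nhds_iff_ball.1 (h1.and (Ω.isOpen.eventually_mem hz))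
  exact ⟨r, hr, ρ.toFun z + 1, by linarith [ρ.pos z hz], fun w hw => (h2 w hw).2,
    fun w hw => (h2 w hw).1.le⟩

/-- `ρ` is locally bounded, and small balls are joined to their centre by segments. This gives
separability of `(Ω, d)` and the continuity of `(Ω, d) → (Ω, d_ρ)`. -/
theorem continuous_ofEuclidean (ρ : Density Ω) : Continuous (ofEuclidean ρ) := by
  refine continuous_iff_continuousAt.2 fun z => ?_
  obtain ⟨r, hr, M, hM, hΩ, hρ⟩ := exists_local_bound ρ z.2
  refine tendsto_iff_dist_tendsto_zero.2 ?_
  have hlim : Tendsto (fun w : Ω.carrier => M * dist w z) (𝓝 z) (𝓝 0) := by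
    have : Continuous (fun w : Ω.carrier => M * dist w z) := by fun_prop
    simpa using this.tendsto z
  refine squeeze_zero' (Eventually.of_forall fun _ => dist_nonneg) ?_ hlim
  filter_upwards [Metric.ball_mem_nhds z hr] with w hw
  have hseg : segment ℝ w.1 z.1 ⊆ Metric.ball z.1 r :=
    (convex_ball _ _).segment_subset hw (Metric.mem_ball_self hr)
  obtain ⟨γ, hγ⟩ := exists_isCurve_dist_of_segment hseg
  have hγ' : IsCurve Ω.carrier w.1 z.1 (dist w.1 z.1) γ :=
    ⟨hγ.nonneg, hγ.arclength, hγ.source, hγ.target, fun t ht => hΩ (hγ.mem t ht)⟩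
  exact (rhoDist_le_of_isCurve (ofEuclidean ρ w) (ofEuclidean ρ z) hγ').trans
    (rhoLength_le_mul hγ' fun t ht => hρ _ (hγ.mem t ht))

theorem continuous_changeDensity (ρ : Density Ω) :
    Continuous (changeDensity ρ : InternalSpace Ω → RhoSpace Ω ρ) := by
  have h1 : Continuous (fun x : InternalSpace Ω => (⟨x.1, x.2⟩ : Ω.carrier)) := by
    refine (LipschitzWith.of_dist_le_mul (K := 1) fun x y => ?_).continuous
    rw [NNReal.coe_one, one_mul]
    exact euclideanDist_le_internalDist x y
  exact (continuous_ofEuclidean ρ).comp h1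

/-- Needed to extract countable subcovers from the neighbourhoods of boundary points. -/
instance : SecondCountableTopology (InternalClosure Ω) := by
  have h1 : TopologicalSpace.SeparableSpace (InternalSpace Ω) :=
    (Function.Surjective.denseRange fun x => ⟨⟨x.1, x.2⟩, rfl⟩ :
      DenseRange (ofEuclidean (Density.one Ω))).separableSpace (continuous_ofEuclidean _)
  exact UniformSpace.secondCountable_of_separable _

theorem lipschitz_toInternal {c : ℝ} (hc : 0 < c) (hρ : ∀ y ∈ Ω.carrier, c < ρ.toFun y)
    (x y : RhoSpace Ω ρ) : dist (toInternal x) (toInternal y) ≤ c⁻¹ * dist x y := by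
  rw [le_inv_mul_iff₀ hc]
  refine mul_le_rhoDist dist_nonneg (fun L γ h => ?_) fun z _ => (hρ z.1 z.2).le
  exact internalDist_le_of_isCurve (toInternal x) (toInternal y) h

theorem uniformContinuous_toInternal (hρ : ∃ c : ℝ, 0 < c ∧ ∀ y ∈ Ω.carrier, c < ρ.toFun y) :
    UniformContinuous (toInternal (ρ := ρ)) := by
  obtain ⟨c, hc, hρ⟩ := hρ
  refine (LipschitzWith.of_dist_le_mul (K := (c⁻¹).toNNReal) fun x y => ?_).uniformContinuous
  rw [Real.coe_toNNReal _ (inv_nonneg.2 hc.le)]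
  exact lipschitz_toInternal hc hρ x y

end Distance

/-! ### The Euclidean distance to the boundary. -/

section BoundaryDistance

theorem frontier_nonempty (hΩ : Ω.carrier ≠ univ) : (frontier Ω.carrier).Nonempty :=
  nonempty_frontier_iff.2 ⟨Ω.isConnected.nonempty, hΩ⟩

theorem bdist_pos (hΩ : Ω.carrier ≠ univ) {y : EuclideanSpace ℝ (Fin n)} (hy : y ∈ Ω.carrier) :
    0 < bdist Ω y := by
  refine (isClosed_frontier.notMem_iff_infDist_pos (frontier_nonempty hΩ)).1 fun h => ?_
  rw [Ω.isOpen.frontier_eq] at h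
  exact h.2 hy

theorem bdist_le_add (x y : EuclideanSpace ℝ (Fin n)) : bdist Ω x ≤ bdist Ω y + dist x y :=
  Metric.infDist_le_infDist_add_dist

/-- The ball misses the frontier, so it is a connected set covered by the disjoint open sets `Ω` and
the complement of its closure. -/
theorem ball_bdist_subset {y : EuclideanSpace ℝ (Fin n)} (hy : y ∈ Ω.carrier) :
    Metric.ball y (bdist Ω y) ⊆ Ω.carrier := by
  intro w hw
  by_contra hwΩ
  have hpos : 0 < bdist Ω y := (dist_nonneg.trans_lt hw)
  have hout : ∀ p ∈ Metric.ball y (bdist Ω y), p ∈ Ω.carrier ∨ p ∈ (closure Ω.carrier)ᶜ := by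
    intro p hp
    by_contra! hp'
    have hpf : p ∈ frontier Ω.carrier := by
      rw [Ω.isOpen.frontier_eq]; exact ⟨not_not.1 hp'.2, hp'.1⟩
    have := Metric.infDist_le_dist_of_mem (x := y) hpf
    rw [Metric.mem_ball, dist_comm] at hp
    exact absurd (hp.trans_le this) (lt_irrefl _)
  obtain ⟨p, -, hp1, hp2⟩ := (convex_ball y (bdist Ω y)).isPreconnected Ω.carrier
    (closure Ω.carrier)ᶜ Ω.isOpen isClosed_closure.isOpen_compl hout
    ⟨y, Metric.mem_ball_self hpos, hy⟩ ⟨w, hw, (hout w hw).resolve_left hwΩ⟩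
  exact hp2 (subset_closure hp1)

/-- The Euclidean boundary distance is at most the distance to any point of the internal
boundary. -/
theorem bdist_le_dist {x : InternalClosure Ω} (hx : x ∈ internalBoundary Ω) (y : InternalSpace Ω) :
    bdist Ω y.1 ≤ dist (y : InternalClosure Ω) x := by
  -- Otherwise points of `Ω` approximating `x` stay in a closed Euclidean ball inside `Ω`. Its image
  -- in the completion is compact, hence closed, so `x` would belong to `Ω`.
  by_contra! hlt
  obtain ⟨s, hs1, hs2⟩ := exists_between hlt
  have hsub : Metric.closedBall y.1 s ⊆ Ω.carrier :=
    (Metric.closedBall_subset_ball hs2).trans (ball_bdist_subset y.2)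
  let j : Metric.closedBall y.1 s → InternalClosure Ω := fun w =>
    ((ofEuclidean (Density.one Ω) ⟨w.1, hsub w.2⟩ : InternalSpace Ω) : InternalClosure Ω)
  have hj : Continuous j := (UniformSpace.Completion.continuous_coe _).comp
    ((continuous_ofEuclidean _).comp (by fun_prop))
  have : CompactSpace (Metric.closedBall y.1 s) :=
    isCompact_iff_compactSpace.1 (isCompact_closedBall _ _)
  have hclosed : IsClosed (range j) := (isCompact_range hj).isClosed
  have hmem : x ∈ closure (range j) := by
    have h1 := UniformSpace.Completion.denseRange_coe.open_subset_closure_inter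
      (Metric.isOpen_ball (x := (y : InternalClosure Ω)) (ε := s))
      (show x ∈ Metric.ball (y : InternalClosure Ω) s by rwa [Metric.mem_ball, dist_comm])
    refine closure_mono ?_ h1
    rintro _ ⟨hb, w, rfl⟩
    rw [Metric.mem_ball, UniformSpace.Completion.dist_eq] at hb
    exact ⟨⟨w.1, Metric.mem_closedBall.2 ((euclideanDist_le_internalDist w y).trans hb.le)⟩, rfl⟩
  obtain ⟨w, hw⟩ := hclosed.closure_eq ▸ hmem
  exact hx ⟨_, hw⟩

end BoundaryDistance

/-! ### Chaining along a path covered by finitely many pieces. -/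

section Chain

/-- From `a`, jump to the last time `s` spent in a piece containing `a`. That piece is never met
again after `s`, and the remaining pieces, being closed, cover `s` too; so each piece is paid for
once. -/
theorem dist_le_card_mul_of_isClosed {P ι : Type*} [PseudoMetricSpace P] [DecidableEq ι] {φ : ℝ → P}
    {A : ι → Set ℝ} (hA : ∀ c, IsClosed (A c)) {b K : ℝ}
    (hK : ∀ c, ∀ s ∈ A c, ∀ t ∈ A c, dist (φ s) (φ t) ≤ K) (T : Finset ι) :
    ∀ a ≤ b, Icc a b ⊆ ⋃ c ∈ T, A c → dist (φ a) (φ b) ≤ T.card * K := by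
  induction T using Finset.strongInduction with
  | H T ih =>
    intro a hab hT
    obtain ⟨c, hcT, hac⟩ : ∃ c ∈ T, a ∈ A c := by simpa using hT ⟨le_rfl, hab⟩
    have hK0 : 0 ≤ K := dist_nonneg.trans (hK c a hac a hac)
    have hScomp : IsCompact (A c ∩ Icc a b) := isCompact_Icc.inter_left (hA c)
    have hSmem := hScomp.sSup_mem ⟨a, hac, le_rfl, hab⟩
    set s := sSup (A c ∩ Icc a b)
    have h1 := hK c a hac s hSmem.1
    have hcard : ((T.erase c).card : ℝ) + 1 = T.card := by
      exact_mod_cast Finset.card_erase_add_one hcT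
    rcases hSmem.2.2.eq_or_lt with hsb | hsb
    · rw [hsb] at h1
      rw [← hcard, add_mul, one_mul]
      have : 0 ≤ ((T.erase c).card : ℝ) * K := by positivity
      linarith
    · have hsub : Icc s b ⊆ ⋃ d ∈ T.erase c, A d := by
        rw [← closure_Ioc hsb.ne]
        refine closure_minimal (fun t ht => ?_)
          ((T.erase c).finite_toSet.isClosed_biUnion fun d _ => hA d)
        have htab : t ∈ Icc a b := ⟨hSmem.2.1.trans ht.1.le, ht.2⟩
        obtain ⟨d, hdT, htd⟩ : ∃ d ∈ T, t ∈ A d := by simpa using hT htab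
        refine mem_biUnion (Finset.mem_coe.2 (Finset.mem_erase.2 ⟨?_, hdT⟩)) htd
        rintro rfl
        exact absurd (le_csSup hScomp.bddAbove ⟨htd, htab⟩) (not_le.2 ht.1)
      have h2 := ih _ (Finset.erase_ssubset hcT) s hsb.le hsub
      rw [← hcard, add_mul, one_mul]
      linarith [dist_triangle (φ a) (φ s) (φ b)]

/-- A path covered by finitely many pieces, each with image of diameter at most `K`. -/
theorem dist_le_card_mul {P ι : Type*} [PseudoMetricSpace P] {φ : ℝ → P} (hφ : Continuous φ)
    {A : ι → Set ℝ} {a b K : ℝ} (hab : a ≤ b)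
    (hK : ∀ c, ∀ s ∈ A c, ∀ t ∈ A c, dist (φ s) (φ t) ≤ K) (T : Finset ι)
    (hT : Icc a b ⊆ ⋃ c ∈ T, A c) : dist (φ a) (φ b) ≤ T.card * K := by
  classical
  -- By continuity of `φ` the diameter bound survives passing to the closures of the pieces.
  refine dist_le_card_mul_of_isClosed (A := fun c => closure (A c)) (fun _ => isClosed_closure)
    (fun c s hs t ht => ?_) T a hab (hT.trans (iUnion₂_mono fun _ _ => subset_closure))
  have hmem : (s, t) ∈ closure (A c ×ˢ A c) := by rw [closure_prod_eq]; exact ⟨hs, ht⟩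
  exact closure_minimal (s := A c ×ˢ A c) (t := {p : ℝ × ℝ | dist (φ p.1) (φ p.2) ≤ K})
    (fun p hp => hK c p.1 hp.1 p.2 hp.2)
    (isClosed_le (by fun_prop) continuous_const) hmem

end Chain

/-! ### The upper bound for `d_ρ` in a John domain. -/

section UpperBound

variable {ρ : Density Ω} {x : InternalClosure Ω} {α β R : ℝ}

theorem dist_toInternal_closure_le (y z : InternalSpace Ω) :
    dist (z : InternalClosure Ω) x ≤ dist (y : InternalClosure Ω) x + dist y z := by
  have := dist_triangle (z : InternalClosure Ω) y x
  rw [UniformSpace.Completion.dist_eq, dist_comm z y] at this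
  linarith

/-- The point `w'` lies at arc length `r` on the John curve of `w`. There `ρ(γ(t)) ≤ (α t) ^ β`,
because `β ≤ 0`, and this integrates to the stated cost, because `β > -1`. -/
theorem exists_john_retreat (hα : 0 < α) {x₀ : EuclideanSpace ℝ (Fin n)}
    (hJ : ∀ x ∈ Ω.carrier, ∃ L γ,
      IsCurve Ω.carrier x x₀ L γ ∧ ∀ t ∈ Icc 0 L, α * t ≤ bdist Ω (γ t))
    (hx : x ∈ internalBoundary Ω) (hβ : -1 < β) (hβ0 : β ≤ 0)
    (hρ : ∀ y : InternalSpace Ω, dist (y : InternalClosure Ω) x < R →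
      ρ.toFun y.1 ≤ bdist Ω y.1 ^ β)
    (w : RhoSpace Ω ρ) {r : ℝ} (hr : 0 < r)
    (hwR : dist (toInternal w : InternalClosure Ω) x + r < R)
    (hw₀ : dist (toInternal w : InternalClosure Ω) x + r ≤ bdist Ω x₀) :
    ∃ w' : RhoSpace Ω ρ, dist (toInternal w) (toInternal w') ≤ r ∧ α * r ≤ bdist Ω w'.1 ∧
      dist w w' ≤ α ^ β / (1 + β) * r ^ (1 + β) := by
  obtain ⟨L, γ, hγ, hd⟩ := hJ w.1 w.2
  -- The John curve is long enough: `w` is closer to the boundary than `x₀` by at least `r`, so `x₀`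
  -- is at distance at least `r` from `w`.
  have hrL : r ≤ L := by
    have h1 := bdist_le_add (Ω := Ω) x₀ w.1
    have h2 := bdist_le_dist hx (toInternal w)
    have h3 := hγ.dist_endpoints_le
    rw [dist_comm] at h3
    change bdist Ω w.1 ≤ _ at h2
    linarith
  have hγr := hγ.restrict_left hr.le hrL
  refine ⟨ofEuclidean ρ ⟨γ r, hγ.mem r ⟨hr.le, hrL⟩⟩, ?_, hd r ⟨hr.le, hrL⟩, ?_⟩
  · exact internalDist_le_of_isCurve _ (ofEuclidean _ ⟨γ r, hγ.mem r ⟨hr.le, hrL⟩⟩) hγr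
  · refine (rhoDist_le_of_isCurve w (ofEuclidean ρ ⟨γ r, hγ.mem r ⟨hr.le, hrL⟩⟩) hγr).trans ?_
    have hint : IntervalIntegrable (fun t : ℝ => α ^ β * t ^ β) volume 0 r :=
      (intervalIntegral.intervalIntegrable_rpow' hβ).const_mul _
    have h1 : rhoLength ρ r γ ≤ ∫ t in (0 : ℝ)..r, α ^ β * t ^ β := by
      -- The open interval matters: at `t = 0` the convention `0 ^ β = 0` for `β ≠ 0` would break
      -- the comparison.
      refine intervalIntegral.integral_mono_on_of_le_Ioo hr.le
        ((continuousOn_rho ρ hγr).intervalIntegrable_of_Icc hr.le) hint fun t ht => ?_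
      have htL : t ∈ Icc 0 L := ⟨ht.1.le, ht.2.le.trans hrL⟩
      let v : InternalSpace Ω := ofEuclidean _ ⟨γ t, hγ.mem t htL⟩
      have hv : dist (toInternal w) v ≤ t :=
        internalDist_le_of_isCurve _ v (hγ.restrict_left htL.1 htL.2)
      have h2 : ρ.toFun (γ t) ≤ bdist Ω (γ t) ^ β :=
        hρ v (by linarith [dist_toInternal_closure_le (x := x) (toInternal w) v, ht.2])
      rw [← Real.mul_rpow hα.le ht.1.le]
      exact h2.trans (Real.rpow_le_rpow_of_nonpos (mul_pos hα ht.1) (hd t htL) hβ0)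
    refine h1.trans (le_of_eq ?_)
    rw [intervalIntegral.integral_const_mul, integral_rpow (Or.inl hβ),
      Real.zero_rpow (by linarith), sub_zero, add_comm β 1]
    ring

/-- On the segment the boundary distance stays at least `s`, so `ρ ≤ s ^ β` there, and the length is
at most `s`. -/
theorem rhoDist_le_of_bdist (hβ0 : β ≤ 0)
    (hρ : ∀ y : InternalSpace Ω, dist (y : InternalClosure Ω) x < R →
      ρ.toFun y.1 ≤ bdist Ω y.1 ^ β)
    (v w : RhoSpace Ω ρ) {s : ℝ} (hs : 0 < s) (hvs : 2 * s ≤ bdist Ω v.1)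
    (hvw : dist v.1 w.1 ≤ s) (hvR : dist (toInternal v : InternalClosure Ω) x + s < R) :
    dist v w ≤ s ^ (1 + β) := by
  have hb : 0 < bdist Ω v.1 := by linarith
  have hseg : segment ℝ v.1 w.1 ⊆ Ω.carrier := by
    refine ((convex_ball _ _).segment_subset (Metric.mem_ball_self hb) ?_).trans
      (ball_bdist_subset v.2)
    rw [Metric.mem_ball, dist_comm]; linarith
  obtain ⟨γ, hγ⟩ := exists_isCurve_dist_of_segment hseg
  refine (rhoDist_le_of_isCurve v w hγ).trans ?_
  have h1 : rhoLength ρ (dist v.1 w.1) γ ≤ s ^ β * dist v.1 w.1 := by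
    refine rhoLength_le_mul hγ fun t ht => ?_
    let u : InternalSpace Ω := ofEuclidean _ ⟨γ t, hγ.mem t ht⟩
    have hγt := hγ.restrict_left ht.1 ht.2
    have hu : dist (toInternal v) u ≤ t := internalDist_le_of_isCurve _ u hγt
    have h2 : ρ.toFun (γ t) ≤ bdist Ω (γ t) ^ β :=
      hρ u (by linarith [dist_toInternal_closure_le (x := x) (toInternal v) u, ht.2])
    refine h2.trans (Real.rpow_le_rpow_of_nonpos hs ?_ hβ0)
    linarith [bdist_le_add (Ω := Ω) v.1 (γ t), hγt.dist_endpoints_le, ht.2]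
  refine h1.trans ?_
  rw [add_comm, Real.rpow_add_one hs.ne']
  gcongr

/-- In a John domain with `ρ ≤ d ^ β` near a point of the internal boundary, `d_ρ` is there at
most a multiple of `d ^ (1 + β)`. -/
theorem exists_rhoDist_le_rpow (hΩ : Ω.carrier ≠ univ) (hJohn : IsJohn Ω)
    (hx : x ∈ internalBoundary Ω) (hβ : -1 < β) (hβ0 : β ≤ 0) (hR : 0 < R)
    (hρ : ∀ y : InternalSpace Ω, dist (y : InternalClosure Ω) x < R →
      ρ.toFun y.1 ≤ bdist Ω y.1 ^ β) :
    ∃ C > 0, ∃ r > 0, ∀ y z : RhoSpace Ω ρ, dist (toInternal y : InternalClosure Ω) x < r →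
      dist (toInternal z : InternalClosure Ω) x < r →
      dist y z ≤ C * dist (toInternal y) (toInternal z) ^ (1 + β) := by
  obtain ⟨α, hα, hα1, x₀, hx₀, hJ⟩ := hJohn
  obtain ⟨S, -, hSfin, hS⟩ := (isCompact_closedBall (0 : EuclideanSpace ℝ (Fin n)) 2).finite_cover_balls
    (show 0 < α / 4 by linarith)
  set T := hSfin.toFinset with hT
  have h1β : 0 < 1 + β := by linarith
  -- Cost, in units of `r ^ (1 + β)`, of two John retreats and one segment between deep points.
  set κ : ℝ := 2 * (α ^ β / (1 + β)) + (α / 2) ^ (1 + β) with hκ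
  have hκ0 : 0 < κ := by positivity
  have hb₀ := bdist_pos hΩ hx₀
  set D := min R (bdist Ω x₀)
  have hD : 0 < D := lt_min hR hb₀
  have hDR : D ≤ R := min_le_left _ _
  have hDb : D ≤ bdist Ω x₀ := min_le_right _ _
  -- The `+ 1` makes positivity immediate. With `D / 16` the curve stays within `5 D / 16` of `x`,
  -- and retreats of length `r < D / 4` followed by segments of length at most `r / 2` stay within
  -- `D`.
  refine ⟨(T.card + 1) * κ * 2 ^ (1 + β), by positivity, D / 16, by positivity, ?_⟩
  intro y z hy hz
  rcases eq_or_ne y z with rfl | hyz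
  · rw [dist_self, dist_self, Real.zero_rpow h1β.ne', mul_zero]
  have hδ : 0 < dist (toInternal y) (toInternal z) := by
    refine lt_of_lt_of_le (dist_pos.2 fun h => hyz ?_) (euclideanDist_le_internalDist _ _)
    exact Subtype.ext h
  have hδ2 : dist (toInternal y) (toInternal z) < D / 8 := by
    rw [← UniformSpace.Completion.dist_eq]
    linarith [dist_triangle_right (toInternal y : InternalClosure Ω) (toInternal z) x]
  set δ := dist (toInternal y) (toInternal z)
  set r := 2 * δ with hr
  have hr0 : 0 < r := by positivity
  obtain ⟨L, γ, hγ, hL⟩ := exists_isCurve_of_internalDist_lt (show δ < r by linarith)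
  have hL0 := hγ.nonneg
  let φ : ℝ → RhoSpace Ω ρ := fun t =>
    ofEuclidean ρ ⟨γ (projIcc 0 L hL0 t), hγ.mem _ (projIcc 0 L hL0 t).2⟩
  have hφ : Continuous φ := (continuous_ofEuclidean ρ).comp
    ((hγ.continuousOn.domRestrict.comp continuous_projIcc).subtype_mk _)
  have hφy : ∀ t, dist (toInternal y) (toInternal (φ t)) ≤ L := fun t =>
    (internalDist_le_of_isCurve _ (toInternal (φ t)) (hγ.restrict_left (projIcc 0 L hL0 t).2.1
      (projIcc 0 L hL0 t).2.2)).trans (projIcc 0 L hL0 t).2.2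
  have hφx : ∀ t, dist (toInternal (φ t) : InternalClosure Ω) x < 5 * (D / 16) := fun t => by
    linarith [dist_toInternal_closure_le (x := x) (toInternal y) (toInternal (φ t)), hφy t]
  -- `ψ` need not be continuous: it only sorts the parameters `t` into pieces, while the chain runs
  -- along `φ`.
  choose ψ hψ1 hψ2 hψ3 using fun t => exists_john_retreat hα hJ hx hβ hβ0 hρ (φ t) hr0
    (by linarith [hφx t]) (by linarith [hφx t])
  have hmain := dist_le_card_mul hφ (a := 0) (b := L) (K := κ * r ^ (1 + β))
    (A := fun c => {t | dist (ψ t).1 (y.1 + r • c) < α * r / 4}) hL0 ?_ T ?_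
  · have h0 : φ 0 = y := by
      refine Subtype.ext ?_
      change γ (projIcc 0 L hL0 0) = y.1
      rw [projIcc_left]; exact hγ.source
    have h1 : φ L = z := by
      refine Subtype.ext ?_
      change γ (projIcc 0 L hL0 L) = z.1
      rw [projIcc_right]; exact hγ.target
    rw [h0, h1] at hmain
    refine hmain.trans ?_
    rw [hr, Real.mul_rpow zero_le_two hδ.le]
    have : 0 ≤ κ * (2 ^ (1 + β) * δ ^ (1 + β)) := by positivity
    nlinarith
  · intro c s hs t ht
    have h1 : dist (ψ s).1 (ψ t).1 ≤ α * r / 2 := by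
      linarith [dist_triangle_right (ψ s).1 (ψ t).1 (y.1 + r • c), mem_ofPred.1 hs, mem_ofPred.1 ht]
    have hαr : α * r ≤ r := mul_le_of_le_one_left hr0.le hα1
    have h2 := rhoDist_le_of_bdist hβ0 hρ (ψ s) (ψ t) (s := α * r / 2) (by positivity)
      (by linarith [hψ2 s]) h1 (by
        linarith [dist_toInternal_closure_le (x := x) (toInternal (φ s)) (toInternal (ψ s)),
          hφx s, hψ1 s])
    have h3 : (α * r / 2) ^ (1 + β) = (α / 2) ^ (1 + β) * r ^ (1 + β) := by
      rw [← Real.mul_rpow (by positivity) hr0.le]; ring_nf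
    have h4 := dist_triangle4 (φ s) (ψ s) (ψ t) (φ t)
    have h5 := hψ3 t
    rw [dist_comm] at h5
    rw [hκ, add_mul, ← h3]
    linarith [hψ3 s]
  · intro t _
    have hmem : r⁻¹ • ((ψ t).1 - y.1) ∈ Metric.closedBall (0 : EuclideanSpace ℝ (Fin n)) 2 := by
      rw [mem_closedBall_zero_iff, norm_smul, norm_inv, Real.norm_of_nonneg hr0.le,
        inv_mul_le_iff₀ hr0, ← dist_eq_norm, dist_comm]
      have h1 := euclideanDist_le_internalDist (toInternal y) (toInternal (ψ t))
      have h2 := dist_triangle (toInternal y) (toInternal (φ t)) (toInternal (ψ t))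
      have h3 : dist y.1 (ψ t).1 ≤ dist (toInternal y) (toInternal (ψ t)) := h1
      linarith [hφy t, hψ1 t]
    obtain ⟨c, hc, hcb⟩ := mem_iUnion₂.1 (hS hmem)
    refine mem_iUnion₂.2 ⟨c, hSfin.mem_toFinset.2 hc, ?_⟩
    rw [Metric.mem_ball, dist_eq_norm] at hcb
    change dist (ψ t).1 (y.1 + r • c) < α * r / 4
    have h1 : (ψ t).1 - (y.1 + r • c) = r • (r⁻¹ • ((ψ t).1 - y.1) - c) := by
      rw [smul_sub, smul_inv_smul₀ hr0.ne', sub_sub]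
    rw [dist_eq_norm, h1, norm_smul, Real.norm_of_nonneg hr0.le]
    nlinarith

end UpperBound

/-! ### Extension of the identity map to the completions. -/

section Closure

variable {ρ : Density Ω}

/-- The extension to the completions of the identity map `(Ω, d_ρ) → (Ω, d)`. -/
noncomputable def closureMap (ρ : Density Ω) : RhoClosure Ω ρ → InternalClosure Ω :=
  UniformSpace.Completion.map toInternal

theorem continuous_closureMap : Continuous (closureMap ρ) := UniformSpace.Completion.continuous_map

theorem closureMap_coe (hu : UniformContinuous (toInternal (ρ := ρ))) (y : RhoSpace Ω ρ) :
    closureMap ρ y = (toInternal y : InternalClosure Ω) := UniformSpace.Completion.map_coe hu y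

theorem mem_closure_inter_range {V : Set (RhoClosure Ω ρ)} (hV : IsOpen V) {ξ η : RhoClosure Ω ρ}
    (hξ : ξ ∈ V) (hη : η ∈ V) :
    (ξ, η) ∈ closure ((V ∩ range fun y : RhoSpace Ω ρ => (y : RhoClosure Ω ρ)) ×ˢ
      (V ∩ range fun y : RhoSpace Ω ρ => (y : RhoClosure Ω ρ))) := by
  rw [closure_prod_eq]
  exact ⟨UniformSpace.Completion.denseRange_coe.open_subset_closure_inter hV hξ,
    UniformSpace.Completion.denseRange_coe.open_subset_closure_inter hV hη⟩

theorem rhoClosure_dist_le_rpow (hu : UniformContinuous (toInternal (ρ := ρ)))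
    {x : InternalClosure Ω} {C a r : ℝ} (ha : 0 < a)
    (h : ∀ y z : RhoSpace Ω ρ, dist (toInternal y : InternalClosure Ω) x < r →
      dist (toInternal z : InternalClosure Ω) x < r →
      dist y z ≤ C * dist (toInternal y) (toInternal z) ^ a)
    {ξ η : RhoClosure Ω ρ} (hξ : dist (closureMap ρ ξ) x < r) (hη : dist (closureMap ρ η) x < r) :
    dist ξ η ≤ C * dist (closureMap ρ ξ) (closureMap ρ η) ^ a := by
  have hc := continuous_closureMap (ρ := ρ)
  have hV : IsOpen (closureMap ρ ⁻¹' Metric.ball x r) := Metric.isOpen_ball.preimage hc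
  have hcont : Continuous fun p : RhoClosure Ω ρ × RhoClosure Ω ρ =>
      C * dist (closureMap ρ p.1) (closureMap ρ p.2) ^ a := by
    refine continuous_const.mul (Continuous.rpow_const ?_ fun _ => Or.inr ha.le)
    fun_prop
  refine ContinuousWithinAt.closure_le (mem_closure_inter_range hV hξ hη)
    (f := fun p : RhoClosure Ω ρ × RhoClosure Ω ρ => dist p.1 p.2)
    continuous_dist.continuousWithinAt hcont.continuousWithinAt ?_
  rintro ⟨_, _⟩ ⟨⟨hy, y, rfl⟩, hz, z, rfl⟩
  simp only [mem_preimage, Metric.mem_ball, closureMap_coe hu, UniformSpace.Completion.dist_eq]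
    at hy hz ⊢
  exact h y z hy hz

/-- If the image were a point `z` of `Ω`, points of `Ω` tending to `ξ` would tend to `z` for `d`,
hence also for `d_ρ`, so `ξ = z`. -/
theorem closureMap_mem_boundary (hu : UniformContinuous (toInternal (ρ := ρ)))
    {ξ : RhoClosure Ω ρ} (hξ : ξ ∈ rhoBoundary Ω ρ) : closureMap ρ ξ ∈ internalBoundary Ω := by
  rintro ⟨z, hz⟩
  have hne : (comap (fun y : RhoSpace Ω ρ => (y : RhoClosure Ω ρ)) (𝓝 ξ)).NeBot :=
    UniformSpace.Completion.isDenseInducing_coe.comap_nhds_neBot ξ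
  set l := comap (fun y : RhoSpace Ω ρ => (y : RhoClosure Ω ρ)) (𝓝 ξ)
  have h1 : Tendsto (fun y : RhoSpace Ω ρ => (toInternal y : InternalClosure Ω)) l
      (𝓝 (z : InternalClosure Ω)) := by
    have h2 := (continuous_closureMap (ρ := ρ)).continuousAt.tendsto.comp
      (tendsto_comap (f := fun y : RhoSpace Ω ρ => (y : RhoClosure Ω ρ)) (x := 𝓝 ξ))
    rw [← hz] at h2
    exact h2.congr fun y => closureMap_coe hu y
  have h3 : Tendsto (fun y : RhoSpace Ω ρ => toInternal y) l (𝓝 z) :=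
    (UniformSpace.Completion.isDenseInducing_coe.isInducing.tendsto_nhds_iff).2 h1
  have h4 : Tendsto (fun y : RhoSpace Ω ρ => y) l (𝓝 (changeDensity ρ z)) :=
    (continuous_changeDensity ρ).continuousAt.tendsto.comp h3
  have h5 := (UniformSpace.Completion.continuous_coe (RhoSpace Ω ρ)).continuousAt.tendsto.comp h4
  exact hξ ⟨_, tendsto_nhds_unique h5 tendsto_comap⟩

/-- The Hölder bound makes the trace on `Ω` of the neighbourhoods of `x` a Cauchy filter for `d_ρ`;
its limit is the preimage. -/
theorem exists_boundary_preimage (hu : UniformContinuous (toInternal (ρ := ρ)))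
    {x : InternalClosure Ω} (hx : x ∈ internalBoundary Ω) {C a r : ℝ} (ha : 0 < a) (hr : 0 < r)
    (h : ∀ y z : RhoSpace Ω ρ, dist (toInternal y : InternalClosure Ω) x < r →
      dist (toInternal z : InternalClosure Ω) x < r →
      dist y z ≤ C * dist (toInternal y) (toInternal z) ^ a) :
    ∃ ξ ∈ rhoBoundary Ω ρ, closureMap ρ ξ = x := by
  have hne : (comap (fun y : InternalSpace Ω => (y : InternalClosure Ω)) (𝓝 x)).NeBot :=
    UniformSpace.Completion.isDenseInducing_coe.comap_nhds_neBot x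
  set l := comap (fun y : InternalSpace Ω => (y : InternalClosure Ω)) (𝓝 x)
  have hcauchy : Cauchy (map (fun y : InternalSpace Ω => (changeDensity ρ y : RhoSpace Ω ρ)) l) := by
    refine Metric.cauchy_iff.2 ⟨inferInstance, fun ε hε => ?_⟩
    have hlim : Tendsto (fun s : ℝ => C * (2 * s) ^ a) (𝓝[>] 0) (𝓝 0) := by
      have hc : Continuous (fun s : ℝ => C * (2 * s) ^ a) :=
        continuous_const.mul (Continuous.rpow_const (by fun_prop) fun _ => Or.inr ha.le)
      have := (hc.tendsto 0).mono_left (nhdsWithin_le_nhds (s := Ioi 0))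
      simpa [Real.zero_rpow ha.ne'] using this
    obtain ⟨s, hs1, hs2, hs3⟩ := ((hlim.eventually_lt_const hε).and
      (Ioo_mem_nhdsGT hr)).exists
    refine ⟨_, image_mem_map (preimage_mem_comap (Metric.ball_mem_nhds x hs2)), ?_⟩
    rintro _ ⟨y, hy, rfl⟩ _ ⟨z, hz, rfl⟩
    have hyx : dist (y : InternalClosure Ω) x < s := hy
    have hzx : dist (z : InternalClosure Ω) x < s := hz
    have h1 : dist y z ≤ 2 * s := by
      rw [← UniformSpace.Completion.dist_eq]
      linarith [dist_triangle_right (y : InternalClosure Ω) z x]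
    have h2 := h (changeDensity ρ y) (changeDensity ρ z) (hyx.trans hs3) (hzx.trans hs3)
    change _ ≤ C * dist y z ^ a at h2
    rcases le_or_gt C 0 with hC | hC
    · exact (h2.trans (mul_nonpos_of_nonpos_of_nonneg hC (by positivity))).trans_lt hε
    · refine lt_of_le_of_lt (h2.trans ?_) hs1
      gcongr
  obtain ⟨ξ, hξ⟩ := cauchy_map_iff_exists_tendsto.1
    (hcauchy.map (UniformSpace.Completion.uniformContinuous_coe (RhoSpace Ω ρ)))
  have hFξ : closureMap ρ ξ = x := by
    have h1 := (continuous_closureMap (ρ := ρ)).continuousAt.tendsto.comp (tendsto_map'_iff.1 hξ)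
    refine tendsto_nhds_unique h1 ?_
    exact (tendsto_comap (f := fun y : InternalSpace Ω => (y : InternalClosure Ω))).congr
      fun y => (closureMap_coe hu (changeDensity ρ y)).symm
  refine ⟨ξ, ?_, hFξ⟩
  rintro ⟨z, rfl⟩
  exact hx ⟨toInternal z, (closureMap_coe hu z).symm.trans hFξ⟩

end Closure

/-! ### The lower bound for `d_ρ` at the boundary. -/

section LowerBound

variable {ρ : Density Ω} {x x₁ : InternalClosure Ω} {m b R : ℝ}

/-- On the initial part of length `d(y, z)` of any curve the boundary distance is at most `d(y, z) +
d(y, x₁)`, and `b ≤ 0` turns this into a lower bound for `ρ`. The term `d(y, x₁)` disappears when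
`y` tends to the boundary point `x₁`. -/
theorem mul_rpow_le_rhoDist (hΩ : Ω.carrier ≠ univ) (hx₁ : x₁ ∈ internalBoundary Ω) (hm : 0 < m)
    (hb : b ≤ 0)
    (hρ : ∀ y : InternalSpace Ω, dist (y : InternalClosure Ω) x < R →
      m * bdist Ω y.1 ^ b ≤ ρ.toFun y.1)
    {y z : RhoSpace Ω ρ} (hy : dist (toInternal y : InternalClosure Ω) x < R / 4)
    (hz : dist (toInternal z : InternalClosure Ω) x < R / 4) :
    m * (dist (toInternal y) (toInternal z) + dist (toInternal y : InternalClosure Ω) x₁) ^ b *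
      dist (toInternal y) (toInternal z) ≤ dist y z := by
  have hyz : dist (toInternal y) (toInternal z) < R / 2 := by
    rw [← UniformSpace.Completion.dist_eq]
    linarith [dist_triangle_right (toInternal y : InternalClosure Ω) (toInternal z) x]
  refine mul_le_rhoDist dist_nonneg
    (fun L γ h => internalDist_le_of_isCurve (toInternal y) (toInternal z) h) fun w hw => ?_
  have h1 := dist_toInternal_closure_le (x := x) (toInternal y) w
  have h2 := dist_toInternal_closure_le (x := x₁) (toInternal y) w
  have hR : 0 < R / 4 := dist_nonneg.trans_lt hy
  refine le_trans ?_ (hρ w (by linarith))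
  have h3 := bdist_le_dist hx₁ w
  exact mul_le_mul_of_nonneg_left
    (Real.rpow_le_rpow_of_nonpos (bdist_pos hΩ w.2) (by linarith) hb) hm.le

theorem mul_rpow_le_rhoClosure_dist (hΩ : Ω.carrier ≠ univ)
    (hu : UniformContinuous (toInternal (ρ := ρ))) (hm : 0 < m) (hb1 : -1 < b) (hb : b ≤ 0)
    (hρ : ∀ y : InternalSpace Ω, dist (y : InternalClosure Ω) x < R →
      m * bdist Ω y.1 ^ b ≤ ρ.toFun y.1)
    {ξ η : RhoClosure Ω ρ} (hξb : ξ ∈ rhoBoundary Ω ρ)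
    (hξ : dist (closureMap ρ ξ) x < R / 4) (hη : dist (closureMap ρ η) x < R / 4) :
    m * dist (closureMap ρ ξ) (closureMap ρ η) ^ (1 + b) ≤ dist ξ η := by
  rcases eq_or_ne (closureMap ρ ξ) (closureMap ρ η) with heq | hne
  · rw [heq, dist_self, Real.zero_rpow (by linarith), mul_zero]
    exact dist_nonneg
  have hδ := dist_pos.2 hne
  have hc := continuous_closureMap (ρ := ρ)
  have hV : IsOpen (closureMap ρ ⁻¹' Metric.ball x (R / 4)) := Metric.isOpen_ball.preimage hc
  set x₁ := closureMap ρ ξ with hx₁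
  have hcont : ContinuousAt (fun p : RhoClosure Ω ρ × RhoClosure Ω ρ =>
      m * (dist (closureMap ρ p.1) (closureMap ρ p.2) + dist (closureMap ρ p.1) x₁) ^ b *
        dist (closureMap ρ p.1) (closureMap ρ p.2)) (ξ, η) := by
    refine (continuousAt_const.mul (ContinuousAt.rpow_const ?_ (Or.inl ?_))).mul ?_
    · exact Continuous.continuousAt (by fun_prop)
    -- With a nonpositive exponent continuity requires a nonzero base, hence the separate case of
    -- equal images above.
    · simp only [← hx₁, dist_self, add_zero]; exact hδ.ne'
    · exact Continuous.continuousAt (by fun_prop)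
  have key := ContinuousWithinAt.closure_le (mem_closure_inter_range hV hξ hη)
    hcont.continuousWithinAt
    (g := fun p : RhoClosure Ω ρ × RhoClosure Ω ρ => dist p.1 p.2)
    continuous_dist.continuousWithinAt ?_
  · simp only [← hx₁, dist_self, add_zero] at key
    rwa [add_comm, Real.rpow_add_one hδ.ne', ← mul_assoc]
  · rintro ⟨_, _⟩ ⟨⟨hy, y, rfl⟩, hz, z, rfl⟩
    simp only [mem_preimage, Metric.mem_ball, closureMap_coe hu] at hy hz
    simp only [closureMap_coe hu, UniformSpace.Completion.dist_eq]
    exact mul_rpow_le_rhoDist hΩ (closureMap_mem_boundary hu hξb) hm hb hρ hy hz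

end LowerBound

/-! ### From local Hölder exponents to the dimension formula. -/

/-- A notion of dimension that is monotone, countably stable and behaves as expected under Hölder
maps is determined on `A` by the sublevel sets of the local Hölder exponent `1 + i` of the
inverse of a map `F` from `A` onto `B`. -/
theorem dim_eq_iSup_of_local_holder {X Y : Type*} [MetricSpace X] [MetricSpace Y]
    [SecondCountableTopology Y] {F : X → Y} {A : Set X} {B : Set Y} (hF : MapsTo F A B)
    (hsurj : SurjOn F A B) {i : Y → ℝ} (hi : ∀ x ∈ B, -1 < i x)
    {DX : Set X → ℝ≥0∞} {DY : Set Y → ℝ≥0∞}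
    (monoX : ∀ s t, s ⊆ t → DX s ≤ DX t) (monoY : ∀ s t, s ⊆ t → DY s ≤ DY t)
    (unionX : ∀ (T : Set Y) (f : Y → Set X) (D : ℝ≥0∞), T.Countable →
      (∀ k ∈ T, DX (f k) ≤ D) → DX (⋃ k ∈ T, f k) ≤ D)
    (unionY : ∀ (T : Set Y) (f : Y → Set Y) (D : ℝ≥0∞), T.Countable →
      (∀ k ∈ T, DY (f k) ≤ D) → DY (⋃ k ∈ T, f k) ≤ D)
    (holderX : ∀ (s : Set X) (t : Set Y) (g : X → Y) (C a : ℝ), MapsTo g s t → 0 < C → 0 < a →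
      (∀ x ∈ s, ∀ y ∈ s, dist x y ≤ C * dist (g x) (g y) ^ a) → DX s ≤ DY t / ENNReal.ofReal a)
    (holderY : ∀ (s : Set Y) (t : Set X) (g : Y → X) (C a : ℝ), MapsTo g s t → 0 < C → 0 < a →
      (∀ x ∈ s, ∀ y ∈ s, dist x y ≤ C * dist (g x) (g y) ^ a) → DY s ≤ DX t / ENNReal.ofReal a)
    (hloc : ∀ x ∈ B, ∀ a b, -1 < a → a < i x → i x < b → ∃ U ∈ 𝓝 x,
      (∀ y ∈ U ∩ B, i y ≤ b) ∧
      (∃ C > 0, ∀ ξ ∈ A ∩ F ⁻¹' U, ∀ η ∈ A ∩ F ⁻¹' U,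
        dist ξ η ≤ C * dist (F ξ) (F η) ^ (1 + a)) ∧
      (∃ C > 0, ∀ ξ ∈ A ∩ F ⁻¹' U, ∀ η ∈ A ∩ F ⁻¹' U,
        dist (F ξ) (F η) ≤ C * dist ξ η ^ (1 + b)⁻¹)) :
    DX A = ⨆ (β : ℝ) (_ : -1 < β), DY {x | x ∈ B ∧ i x ≤ β} / ENNReal.ofReal (1 + β) := by
  refine le_antisymm ?_ (iSup₂_le fun β hβ => ?_)
  · set S := ⨆ (β : ℝ) (_ : -1 < β), DY {x | x ∈ B ∧ i x ≤ β} / ENNReal.ofReal (1 + β)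
    have hS : ∀ β, -1 < β → DY {x | x ∈ B ∧ i x ≤ β} ≤ S * ENNReal.ofReal (1 + β) := by
      intro β hβ
      have hpos : ENNReal.ofReal (1 + β) ≠ 0 := by
        rw [Ne, ENNReal.ofReal_eq_zero]; linarith
      rw [← ENNReal.div_le_iff hpos ENNReal.ofReal_ne_top]
      exact le_iSup₂ (f := fun (β : ℝ) (_ : -1 < β) =>
        DY {x | x ∈ B ∧ i x ≤ β} / ENNReal.ofReal (1 + β)) β hβ
    have key : ∀ θ : ℝ, 1 < θ → DX A ≤ S * ENNReal.ofReal θ := by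
      intro θ hθ
      have hU : ∀ x ∈ B, ∃ U ∈ 𝓝 x, DX (A ∩ F ⁻¹' U) ≤ S * ENNReal.ofReal θ := by
        intro x hx
        have hu : 0 < 1 + i x := by linarith [hi x hx]
        -- Chosen so that `1 + i x + ε = θ * (1 + i x - ε)`: the two local exponents have ratio
        -- exactly `θ`.
        set ε := (θ - 1) / (θ + 1) * (1 + i x) with hε
        have hε0 : 0 < ε := by
          have : 0 < θ - 1 := by linarith
          positivity
        have hθε : ε * (θ + 1) = (θ - 1) * (1 + i x) := by
          rw [hε]; field_simp
        have hεu : ε < 1 + i x := by nlinarith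
        obtain ⟨U, hU, hU1, ⟨C, hC, hU2⟩, -⟩ := hloc x hx (i x - ε) (i x + ε) (by linarith)
          (by linarith) (by linarith)
        refine ⟨U, hU, ?_⟩
        have hpos : 0 < 1 + (i x - ε) := by linarith
        have h1 := holderX (A ∩ F ⁻¹' U) {y | y ∈ B ∧ i y ≤ i x + ε} F C _
          (fun ξ hξ => ⟨hF hξ.1, hU1 _ ⟨hξ.2, hF hξ.1⟩⟩) hC hpos hU2
        refine h1.trans ?_
        rw [ENNReal.div_le_iff (by simpa using hpos) ENNReal.ofReal_ne_top, mul_assoc,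
          ← ENNReal.ofReal_mul (by linarith)]
        refine (hS _ (by linarith)).trans ?_
        gcongr
        nlinarith
      choose! U hU hU' using hU
      obtain ⟨T, hTB, hT, hcov⟩ := TopologicalSpace.countable_cover_nhdsWithin
        (fun x hx => mem_nhdsWithin_of_mem_nhds (t := B) (hU x hx))
      refine (monoX _ _ ?_).trans (unionX T (fun x => A ∩ F ⁻¹' U x) _ hT fun x hx => hU' x (hTB hx))
      intro ξ hξ
      obtain ⟨x, hx, hxU⟩ := mem_iUnion₂.1 (hcov (hF hξ))
      exact mem_iUnion₂.2 ⟨x, hx, hξ, hxU⟩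
    -- `S` may be `∞`; multiplication by it is still continuous at a nonzero limit.
    have hlim : Tendsto (fun θ : ℝ => S * ENNReal.ofReal θ) (𝓝[>] 1) (𝓝 (S * ENNReal.ofReal 1)) :=
      ENNReal.Tendsto.const_mul
        ((ENNReal.continuous_ofReal.tendsto 1).mono_left nhdsWithin_le_nhds) (Or.inl (by simp))
    have := ge_of_tendsto hlim (eventually_nhdsWithin_of_forall fun θ hθ => key θ hθ)
    simpa using this
  · have hβ' : 0 < 1 + β := by linarith
    rw [ENNReal.div_le_iff (by simpa using hβ') ENNReal.ofReal_ne_top]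
    have key : ∀ b : ℝ, β < b →
        DY {x | x ∈ B ∧ i x ≤ β} ≤ DX A * ENNReal.ofReal (1 + b) := by
      intro b hb
      have hb' : 0 < 1 + b := by linarith
      have hU : ∀ x ∈ {x | x ∈ B ∧ i x ≤ β}, ∃ U ∈ 𝓝 x,
          DY ({x | x ∈ B ∧ i x ≤ β} ∩ U) ≤ DX A * ENNReal.ofReal (1 + b) := by
        rintro x ⟨hx, hxβ⟩
        -- Only the lower bound for `d_ρ` is used here, so any lower exponent will do; the midpoint
        -- of `-1` and `i x` is taken.
        obtain ⟨U, hU, -, -, C, hC, hU3⟩ := hloc x hx ((i x - 1) / 2) b (by linarith [hi x hx])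
          (by linarith [hi x hx]) (by linarith)
        refine ⟨U, hU, ?_⟩
        obtain ⟨ξ₀, -, -⟩ := hsurj hx
        have : Nonempty X := ⟨ξ₀⟩
        choose! g hgA hgF using fun y (hy : y ∈ B) => hsurj hy
        have hmem : ∀ y ∈ {x | x ∈ B ∧ i x ≤ β} ∩ U, g y ∈ A ∩ F ⁻¹' U := fun y hy =>
          ⟨hgA y hy.1.1, by rw [mem_preimage, hgF y hy.1.1]; exact hy.2⟩
        have h1 := holderY ({x | x ∈ B ∧ i x ≤ β} ∩ U) A g C (1 + b)⁻¹
          (fun y hy => (hmem y hy).1) hC (by positivity) fun y hy z hz => by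
            have := hU3 _ (hmem y hy) _ (hmem z hz)
            rwa [hgF y hy.1.1, hgF z hz.1.1] at this
        rwa [ENNReal.ofReal_inv_of_pos hb', div_eq_mul_inv, inv_inv] at h1
      choose! U hU hU' using hU
      obtain ⟨T, hTB, hT, hcov⟩ := TopologicalSpace.countable_cover_nhdsWithin
        (fun x hx => mem_nhdsWithin_of_mem_nhds (t := {x | x ∈ B ∧ i x ≤ β}) (hU x hx))
      refine (monoY _ _ ?_).trans
        (unionY T (fun x => {x | x ∈ B ∧ i x ≤ β} ∩ U x) _ hT fun x hx => hU' x (hTB hx))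
      intro y hy
      obtain ⟨x, hx, hxU⟩ := mem_iUnion₂.1 (hcov hy)
      exact mem_iUnion₂.2 ⟨x, hx, hy, hxU⟩
    have hlim : Tendsto (fun b : ℝ => DX A * ENNReal.ofReal (1 + b)) (𝓝[>] β)
        (𝓝 (DX A * ENNReal.ofReal (1 + β))) := by
      refine ENNReal.Tendsto.const_mul ?_ (Or.inl (by simpa using hβ'))
      have : Continuous fun b : ℝ => ENNReal.ofReal (1 + b) :=
        ENNReal.continuous_ofReal.comp (continuous_const.add continuous_id)
      exact (this.tendsto β).mono_left nhdsWithin_le_nhds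
    exact ge_of_tendsto hlim (eventually_nhdsWithin_of_forall fun b hb => key b hb)

/-! ### Local power bounds on the density, and the local Hölder estimates. -/

variable {ρ : Density Ω} {x : InternalClosure Ω} {l : ℝ}

theorem exists_ball_of_eventually_comap {p : InternalSpace Ω → Prop}
    (h : ∀ᶠ y in comap (fun y : InternalSpace Ω => (y : InternalClosure Ω)) (𝓝 x), p y) :
    ∃ R > 0, ∀ y : InternalSpace Ω, dist (y : InternalClosure Ω) x < R → p y := by
  obtain ⟨R, hR, h1⟩ := (Metric.nhds_basis_ball.comap _).eventually_iff.1 h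
  exact ⟨R, hR, fun y hy => h1 hy⟩

theorem log_bdist_neg (hΩ : Ω.carrier ≠ univ) (hx : x ∈ internalBoundary Ω) {y : InternalSpace Ω}
    (hy : dist (y : InternalClosure Ω) x < 1) : Real.log (bdist Ω y.1) < 0 :=
  Real.log_neg (bdist_pos hΩ y.2) ((bdist_le_dist hx y).trans_lt hy)

theorem exists_density_le_rpow (hΩ : Ω.carrier ≠ univ) (hx : x ∈ internalBoundary Ω)
    (hlim : Tendsto (fun y : InternalSpace Ω => Real.log (ρ.toFun y.1) / Real.log (bdist Ω y.1))
      (comap (fun y : InternalSpace Ω => (y : InternalClosure Ω)) (𝓝 x)) (𝓝 l))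
    {a : ℝ} (ha : a < l) : ∃ R > 0, ∀ y : InternalSpace Ω, dist (y : InternalClosure Ω) x < R →
      ρ.toFun y.1 ≤ bdist Ω y.1 ^ a := by
  obtain ⟨R, hR, h⟩ := exists_ball_of_eventually_comap (hlim.eventually_const_lt ha)
  refine ⟨min R 1, by positivity, fun y hy => ?_⟩
  have h1 := h y (hy.trans_le (min_le_left _ _))
  have h2 := log_bdist_neg hΩ hx (hy.trans_le (min_le_right _ _))
  rw [lt_div_iff_of_neg h2] at h1
  rw [← Real.log_le_log_iff (ρ.pos _ y.2) (Real.rpow_pos_of_pos (bdist_pos hΩ y.2) _),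
    Real.log_rpow (bdist_pos hΩ y.2)]
  exact h1.le

/-- The truncation at `0` provides the nonpositive exponent required by the lower bound for `d_ρ`;
when `b > 0` the constant bound `ρ > c` is already enough. -/
theorem exists_mul_rpow_le_density (hΩ : Ω.carrier ≠ univ) (hx : x ∈ internalBoundary Ω)
    (hρ : ∃ c : ℝ, 0 < c ∧ ∀ y ∈ Ω.carrier, c < ρ.toFun y)
    (hlim : Tendsto (fun y : InternalSpace Ω => Real.log (ρ.toFun y.1) / Real.log (bdist Ω y.1))
      (comap (fun y : InternalSpace Ω => (y : InternalClosure Ω)) (𝓝 x)) (𝓝 l))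
    {b : ℝ} (hb : l < b) : ∃ m > 0, ∃ R > 0, ∀ y : InternalSpace Ω,
      dist (y : InternalClosure Ω) x < R → m * bdist Ω y.1 ^ min b 0 ≤ ρ.toFun y.1 := by
  rcases le_or_gt b 0 with hb0 | hb0
  · obtain ⟨R, hR, h⟩ := exists_ball_of_eventually_comap (hlim.eventually_lt_const hb)
    refine ⟨1, one_pos, min R 1, by positivity, fun y hy => ?_⟩
    have h1 := h y (hy.trans_le (min_le_left _ _))
    have h2 := log_bdist_neg hΩ hx (hy.trans_le (min_le_right _ _))
    rw [div_lt_iff_of_neg h2] at h1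
    rw [one_mul, min_eq_left hb0,
      ← Real.log_le_log_iff (Real.rpow_pos_of_pos (bdist_pos hΩ y.2) _) (ρ.pos _ y.2),
      Real.log_rpow (bdist_pos hΩ y.2)]
    exact h1.le
  · obtain ⟨c, hc, h⟩ := hρ
    refine ⟨c, hc, 1, one_pos, fun y _ => ?_⟩
    rw [min_eq_right hb0.le, Real.rpow_zero, mul_one]
    exact (h _ y.2).le

/-- A positive limit would force `ρ ≤ d ^ (l / 2)`, which tends to `0` at `x`, against `ρ > c`. -/
theorem limit_nonpos (hΩ : Ω.carrier ≠ univ) (hx : x ∈ internalBoundary Ω)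
    (hρ : ∃ c : ℝ, 0 < c ∧ ∀ y ∈ Ω.carrier, c < ρ.toFun y)
    (hlim : Tendsto (fun y : InternalSpace Ω => Real.log (ρ.toFun y.1) / Real.log (bdist Ω y.1))
      (comap (fun y : InternalSpace Ω => (y : InternalClosure Ω)) (𝓝 x)) (𝓝 l)) : l ≤ 0 := by
  by_contra! hl
  obtain ⟨c, hc, hρ⟩ := hρ
  obtain ⟨R, hR, h⟩ := exists_density_le_rpow hΩ hx hlim (half_lt_self hl)
  have hs : 0 < min R (c ^ (l / 2)⁻¹) := by positivity
  obtain ⟨y, hy⟩ := (UniformSpace.Completion.denseRange_coe (α := InternalSpace Ω)).exists_mem_open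
    Metric.isOpen_ball ⟨x, Metric.mem_ball_self hs⟩
  rw [Metric.mem_ball] at hy
  have h1 := h y (hy.trans_le (min_le_left _ _))
  have h2 := (bdist_le_dist hx y).trans_lt (hy.trans_le (min_le_right _ _))
  have h3 := Real.rpow_lt_rpow (bdist_pos hΩ y.2).le h2 (half_pos hl)
  rw [Real.rpow_inv_rpow hc.le (half_pos hl).ne'] at h3
  linarith [hρ _ y.2]

theorem exists_local_holder (hΩ : Ω.carrier ≠ univ) (hJohn : IsJohn Ω)
    (hρ : ∃ c : ℝ, 0 < c ∧ ∀ y ∈ Ω.carrier, c < ρ.toFun y) (i : InternalClosure Ω → ℝ)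
    (hlim : ∀ x ∈ internalBoundary Ω,
      Tendsto (fun y : InternalSpace Ω => Real.log (ρ.toFun y.1) / Real.log (bdist Ω y.1))
        (comap (fun y : InternalSpace Ω => (y : InternalClosure Ω)) (𝓝 x)) (𝓝 (i x)))
    (hx : x ∈ internalBoundary Ω) {a b : ℝ} (ha1 : -1 < a) (ha : a < i x) (hb : i x < b) :
    ∃ U ∈ 𝓝 x, (∀ y ∈ U ∩ internalBoundary Ω, i y ≤ b) ∧
      (∃ C > 0, ∀ ξ ∈ rhoBoundary Ω ρ ∩ closureMap ρ ⁻¹' U,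
        ∀ η ∈ rhoBoundary Ω ρ ∩ closureMap ρ ⁻¹' U,
        dist ξ η ≤ C * dist (closureMap ρ ξ) (closureMap ρ η) ^ (1 + a)) ∧
      (∃ C > 0, ∀ ξ ∈ rhoBoundary Ω ρ ∩ closureMap ρ ⁻¹' U,
        ∀ η ∈ rhoBoundary Ω ρ ∩ closureMap ρ ⁻¹' U,
        dist (closureMap ρ ξ) (closureMap ρ η) ≤ C * dist ξ η ^ (1 + b)⁻¹) := by
  have hu := uniformContinuous_toInternal hρ
  have hi0 := limit_nonpos hΩ hx hρ (hlim x hx)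
  obtain ⟨R₀, hR₀, hlt⟩ := exists_ball_of_eventually_comap ((hlim x hx).eventually_lt_const hb)
  obtain ⟨R₁, hR₁, hup⟩ := exists_density_le_rpow hΩ hx (hlim x hx) ha
  obtain ⟨C, hC, R₂, hR₂, hup⟩ := exists_rhoDist_le_rpow hΩ hJohn hx ha1 (by linarith) hR₁ hup
  obtain ⟨m, hm, R₃, hR₃, hlow⟩ := exists_mul_rpow_le_density hΩ hx hρ (hlim x hx) hb
  have hb1 : 0 < 1 + b := by linarith
  have hR : 0 < min (min R₀ R₂) (min (R₃ / 4) (1 / 2)) := by positivity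
  refine ⟨_, Metric.ball_mem_nhds x hR, ?_, ⟨C, hC, ?_⟩,
    ⟨(m⁻¹) ^ (1 + b)⁻¹, by positivity, ?_⟩⟩
  -- The quotient is below `b` at all points of `Ω` near `x`, hence so are its limits, up to
  -- equality, at nearby boundary points.
  · rintro y ⟨hy, hyb⟩
    have hne : (comap (fun y : InternalSpace Ω => (y : InternalClosure Ω)) (𝓝 y)).NeBot :=
      UniformSpace.Completion.isDenseInducing_coe.comap_nhds_neBot y
    refine le_of_tendsto (hlim y hyb) ?_
    filter_upwards [preimage_mem_comap (Metric.isOpen_ball.mem_nhds hy)] with z hz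
    have hz' : dist (z : InternalClosure Ω) x < _ := hz
    exact (hlt z (hz'.trans_le ((min_le_left _ _).trans (min_le_left _ _)))).le
  · rintro ξ ⟨-, hξ⟩ η ⟨-, hη⟩
    have hle := (min_le_left (min R₀ R₂) (min (R₃ / 4) (1 / 2))).trans (min_le_right _ _)
    exact rhoClosure_dist_le_rpow hu (by linarith) hup
      (lt_of_lt_of_le hξ hle) (lt_of_lt_of_le hη hle)
  · rintro ξ ⟨hξb, hξ⟩ η ⟨-, hη⟩
    have hle := (min_le_right (min R₀ R₂) (min (R₃ / 4) (1 / 2))).trans (min_le_left _ _)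
    have hle' := (min_le_right (min R₀ R₂) (min (R₃ / 4) (1 / 2))).trans (min_le_right _ _)
    have h1 := mul_rpow_le_rhoClosure_dist hΩ hu hm (lt_min (by linarith) (by norm_num))
      (min_le_right b 0) hlow hξb (lt_of_lt_of_le hξ hle) (lt_of_lt_of_le hη hle)
    -- Distances at most `1` allow the exponent `1 + min b 0` to be raised to `1 + b`.
    have hd1 : dist (closureMap ρ ξ) (closureMap ρ η) ≤ 1 := by
      have h2 : dist (closureMap ρ ξ) x < 1 / 2 := lt_of_lt_of_le hξ hle'
      have h3 : dist (closureMap ρ η) x < 1 / 2 := lt_of_lt_of_le hη hle'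
      linarith [dist_triangle_right (closureMap ρ ξ) (closureMap ρ η) x]
    have hpow : dist (closureMap ρ ξ) (closureMap ρ η) ^ (1 + b) ≤ m⁻¹ * dist ξ η := by
      rw [le_inv_mul_iff₀ hm]
      refine le_trans ?_ h1
      gcongr m * ?_
      rcases (dist_nonneg (x := closureMap ρ ξ) (y := closureMap ρ η)).eq_or_lt with h0 | h0
      · rw [← h0, Real.zero_rpow hb1.ne']; positivity
      · exact Real.rpow_le_rpow_of_exponent_ge h0 hd1 (by linarith [min_le_left b 0])
    have h4 := Real.rpow_le_rpow (by positivity) hpow (inv_nonneg.2 hb1.le)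
    rwa [Real.rpow_rpow_inv dist_nonneg hb1.ne', Real.mul_rpow (by positivity) dist_nonneg] at h4

theorem surjOn_closureMap (hΩ : Ω.carrier ≠ univ) (hJohn : IsJohn Ω)
    (hρ : ∃ c : ℝ, 0 < c ∧ ∀ y ∈ Ω.carrier, c < ρ.toFun y) (i : InternalClosure Ω → ℝ)
    (hlim : ∀ x ∈ internalBoundary Ω,
      Tendsto (fun y : InternalSpace Ω => Real.log (ρ.toFun y.1) / Real.log (bdist Ω y.1))
        (comap (fun y : InternalSpace Ω => (y : InternalClosure Ω)) (𝓝 x)) (𝓝 (i x)))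
    (hi : ∀ x ∈ internalBoundary Ω, -1 < i x) :
    SurjOn (closureMap ρ) (rhoBoundary Ω ρ) (internalBoundary Ω) := by
  intro x hx
  obtain ⟨a, ha1, ha⟩ := exists_between (hi x hx)
  obtain ⟨R, hR, hup⟩ := exists_density_le_rpow hΩ hx (hlim x hx) ha
  obtain ⟨C, -, r, hr, h⟩ := exists_rhoDist_le_rpow hΩ hJohn hx ha1
    (ha.le.trans (limit_nonpos hΩ hx hρ (hlim x hx))) hR hup
  exact exists_boundary_preimage (uniformContinuous_toInternal hρ) hx (by linarith) hr h

end DensityMetric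

/-! ### The dimension formulas. -/

theorem theorem1 (n : ℕ) (Ω : EuclideanDomainSet n) (hΩ : Ω.carrier ≠ Set.univ)
    (hJohn : IsJohn Ω) (ρ : Density Ω)
    (hρ : ∃ c : ℝ, 0 < c ∧ ∀ y ∈ Ω.carrier, c < ρ.toFun y)
    (i : InternalClosure Ω → ℝ)
    (hlim : ∀ x ∈ internalBoundary Ω,
      Tendsto (fun y : InternalSpace Ω => Real.log (ρ.toFun y.1) / Real.log (bdist Ω y.1))
        (comap (fun y : InternalSpace Ω => (y : InternalClosure Ω)) (𝓝 x)) (𝓝 (i x)))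
    (hi : ∀ x ∈ internalBoundary Ω, -1 < i x) :
    dimH (rhoBoundary Ω ρ) =
        ⨆ (β : ℝ) (_ : -1 < β),
          dimH {x | x ∈ internalBoundary Ω ∧ i x ≤ β} / ENNReal.ofReal (1 + β) ∧
      packingDim (rhoBoundary Ω ρ) =
        ⨆ (β : ℝ) (_ : -1 < β),
          packingDim {x | x ∈ internalBoundary Ω ∧ i x ≤ β} / ENNReal.ofReal (1 + β) := by
  have hu := uniformContinuous_toInternal hρ
  have hmaps : MapsTo (closureMap ρ) (rhoBoundary Ω ρ) (internalBoundary Ω) :=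
    fun _ hξ => closureMap_mem_boundary hu hξ
  have hsurj := surjOn_closureMap hΩ hJohn hρ i hlim hi
  have hloc : ∀ x ∈ internalBoundary Ω, ∀ a b, -1 < a → a < i x → i x < b → _ :=
    fun x hx a b ha1 ha hb => exists_local_holder hΩ hJohn hρ i hlim hx ha1 ha hb
  constructor
  · exact dim_eq_iSup_of_local_holder hmaps hsurj hi (fun _ _ h => dimH_mono h)
      (fun _ _ h => dimH_mono h)
      (fun T f D hT h => by rw [dimH_bUnion hT]; exact iSup₂_le h)
      (fun T f D hT h => by rw [dimH_bUnion hT]; exact iSup₂_le h)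
      (fun _ _ _ _ _ hg hC ha hd => dimH_le_of_holder hg hC ha hd)
      (fun _ _ _ _ _ hg hC ha hd => dimH_le_of_holder hg hC ha hd) hloc
  · exact dim_eq_iSup_of_local_holder hmaps hsurj hi (fun _ _ h => packingDim_mono h)
      (fun _ _ h => packingDim_mono h)
      (fun _ _ _ hT h => packingDim_biUnion_le hT h)
      (fun _ _ _ hT h => packingDim_biUnion_le hT h)
      (fun _ _ _ _ _ hg hC ha hd => packingDim_le_of_holder hg hC ha hd)
      (fun _ _ _ _ _ hg hC ha hd => packingDim_le_of_holder hg hC ha hd) hloc
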